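/- Let $k\ge 1$ be an integer and let $\theta_1\in(\pi/4,\pi/2)$. There is a constant $A_k>0$ (depending on $k$ and $\theta_1$) such that for every real $\lambda<-A_k$ the singular boundary value problem $$u''(\theta)+2\,\frac{\cos(2\theta)}{\sin(2\theta)}\,u'(\theta)=\lambda\,\bigl(u(\theta)^5-u(\theta)\bigr),\quad u(\theta)>0\quad\text{for }\theta\in(0,\theta_1),\qquad u'(0)=0,\quad u(\theta_1)=0,$$ has at least $2k$ distinct solutions $u\in C^2([0,\theta_1])$ with $u(0)\in(0,1)$. More precisely, for every such $\lambda$ and every $j\in\{1,\dots,k\}$ the problem has at least two distinct solutions $u\in C^2([0,\theta_1])$ with $u(0)\in(0,1)$ that have exactly $j$ spikes, i.e. exactly $j$ local maximum points in $(0,\theta_1)$. -/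

import Mathlib

/-- `u` is a classical (`C²` up to the boundary) positive solution on `[0, θ₁]` of
`u'' + 2 (cos 2θ / sin 2θ) u' = lam (u⁵ - u)`, `u > 0` on `(0, θ₁)`, `u'(0) = 0`, `u(θ₁) = 0`.
Only the values of `u` on `[0, θ₁]` matter; the derivative at `0` is the one-sided one. -/
structure IsToroSolution (lam θ₁ : ℝ) (u : ℝ → ℝ) : Prop where
  contDiffOn : ContDiffOn ℝ 2 u (Set.Icc 0 θ₁)
  ode : ∀ θ ∈ Set.Ioo 0 θ₁,
    deriv (deriv u) θ + 2 * (Real.cos (2 * θ) / Real.sin (2 * θ)) * deriv u θ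
      = lam * (u θ ^ 5 - u θ)
  pos : ∀ θ ∈ Set.Ioo 0 θ₁, 0 < u θ
  deriv_zero : HasDerivWithinAt u 0 (Set.Icc 0 θ₁) 0
  boundary : u θ₁ = 0

/-- The solutions with initial value in `(0, 1)`, as functions on `[0, θ₁]`: two solutions are
the same element exactly when they agree on `[0, θ₁]`. -/
def toroSolutions (lam θ₁ : ℝ) : Set (Set.Icc (0 : ℝ) θ₁ → ℝ) :=
  {v | ∃ u : ℝ → ℝ, IsToroSolution lam θ₁ u ∧ u 0 ∈ Set.Ioo (0 : ℝ) 1 ∧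
    Set.domRestrict (Set.Icc 0 θ₁) u = v}

/-- The spikes of `u`: its interior local maximum points. -/
def spikes (θ₁ : ℝ) (u : ℝ → ℝ) : Set ℝ :=
  {θ | θ ∈ Set.Ioo 0 θ₁ ∧ IsLocalMax u θ}

/-- The solutions with initial value in `(0, 1)` having exactly `j` spikes. -/
def toroSpikeSolutions (lam θ₁ : ℝ) (j : ℕ) : Set (Set.Icc (0 : ℝ) θ₁ → ℝ) :=
  {v | ∃ u : ℝ → ℝ, IsToroSolution lam θ₁ u ∧ u 0 ∈ Set.Ioo (0 : ℝ) 1 ∧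
    (spikes θ₁ u).encard = (j : ℕ∞) ∧ Set.domRestrict (Set.Icc 0 θ₁) u = v}

/-!
Write `L = -lam = ω²`; the equation is `u'' + 2 cot (2θ) u' + L (u⁵ - u) = 0`. The solutions are
obtained by shooting from `θ = 0`: for every initial value `d` the singular initial value problem
`u 0 = d`, `u' 0 = 0` has a solution depending continuously on `d` (`exists_shots`, a contraction
for the associated Volterra equation). The nonlinearity is replaced by `toroForce M`, which is
frozen below `0` and above a bound `M` that the solutions do not reach (`IsShot.u_lt`). With this
choice a solution that has reached `0` decreases from then on (`IsShot.v_neg_of_nonpos`), so the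
sign of the end value tells whether the solution has crossed zero before the end point.

In the phase plane a solution with `d ∈ (0, 1)` never meets the equilibrium `(1, 0)`, so it has a
continuous angle `φ` about it, starting from `-π` (`IsAngle`). The angle crosses multiples of `π`
only upwards (`IsAngle.lt_of_le`), and the spikes are the times at which it is `0, 2π, 4π, …`.
Hence the number of spikes is determined by the final angle (`IsAngle.encard_spikes`).

Let `θs` lie between `π / 4` and the end point. The angle at `θs` is negative for `d` near `0`,
where the solution stays close to the equilibrium `0`, and exceeds `2πk` for `d` near `1`, where it
turns fast about the equilibrium `1`. By the intermediate value theorem there is, for each `i < k`,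
a solution whose spike number `i + 1` sits exactly at `θs`. It makes a bounded number of turns on
`[π / 4, θs]` while `ω` is large, and this is possible only if it comes within `O(1 / ω)` of `u = 0`
(`IsAngle.rotation`). Its energy, which increases after `π / 4`, is therefore at `θs` below the
level of `u = 0` by at most a constant (`IsAngle.energy_at_spike`). The descent from the spike gains
energy of order `ω` (`IsShot.energy_gain`), so the solution crosses zero before the end point,
without another critical point (`IsAngle.crosses_zero`).

Now vary `d` in both directions, away from this solution, up to the first zeros of the end value;
they exist because the end value is positive for `d` near `0` and near `1`. In between, the final
velocity is negative, so the final angle stays in the strip `(2πi, 2πi + π)`. The two extreme values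
of `d` give two solutions with `i + 1` spikes that vanish exactly at the end point
(`LargeFrequency.exists_two`).
-/

open Set Filter Topology

/-! ### The singular initial value problem -/

theorem Real.sinc_pos_of_abs_lt_pi {x : ℝ} (hx : |x| < Real.pi) : 0 < Real.sinc x := by
  rcases eq_or_ne x 0 with rfl | h0
  · simp
  obtain ⟨h1, h2⟩ := abs_lt.1 hx
  rcases lt_or_gt_of_ne h0 with h | h
  · rw [← Real.sinc_neg, Real.sinc_of_ne_zero (by linarith)]
    exact div_pos (Real.sin_pos_of_pos_of_lt_pi (by linarith) (by linarith)) (by linarith)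
  · rw [Real.sinc_of_ne_zero h0]
    exact div_pos (Real.sin_pos_of_pos_of_lt_pi h h2) h

theorem Real.mul_sinc (x : ℝ) : x * Real.sinc x = Real.sin x := by
  rcases eq_or_ne x 0 with rfl | h0
  · simp
  · rw [Real.sinc_of_ne_zero h0]; field_simp

/-- Projection of the real line onto `[0, T]`. -/
noncomputable def clampTo (T t : ℝ) : ℝ := max 0 (min t T)

theorem continuous_clampTo (T : ℝ) : Continuous (clampTo T) := by
  unfold clampTo; fun_prop

theorem clampTo_mem {T : ℝ} (hT : 0 ≤ T) (t : ℝ) : clampTo T t ∈ Icc 0 T :=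
  ⟨le_max_left _ _, max_le hT (min_le_right _ _)⟩

theorem clampTo_of_mem {T t : ℝ} (ht : t ∈ Icc 0 T) : clampTo T t = t := by
  simp [clampTo, ht.1, ht.2]

theorem sinc_clampTo_pos {T : ℝ} (hT : 0 < T) (hT' : T < Real.pi / 2) (t : ℝ) :
    0 < Real.sinc (2 * clampTo T t) := by
  obtain ⟨h1, h2⟩ := clampTo_mem hT.le t
  exact Real.sinc_pos_of_abs_lt_pi (by rw [abs_of_nonneg] <;> linarith)

/-- The kernel `τ sinc (2tτ) / sinc (2t)`, with `t` clamped to `[0, T]`. For `0 < t ≤ T` it equals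
`sin (2tτ) / sin (2t)`, and it has no singularity at `t = 0`. -/
noncomputable def sincKernel (T t τ : ℝ) : ℝ :=
  τ * Real.sinc (2 * clampTo T t * τ) / Real.sinc (2 * clampTo T t)

theorem continuous_sincKernel {T : ℝ} (hT : 0 < T) (hT' : T < Real.pi / 2) :
    Continuous fun p : ℝ × ℝ => sincKernel T p.1 p.2 := by
  unfold sincKernel
  have h := Real.continuous_sinc
  have h2 := continuous_clampTo T
  exact Continuous.div (by fun_prop) (by fun_prop) fun p => (sinc_clampTo_pos hT hT' _).ne'

/-- The weighted mean `∫₀¹ sin (2tτ) / sin (2t) f (g (tτ)) dτ`, so that `t * radialMean T f g t` is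
`(sin 2t)⁻¹ ∫₀ᵗ sin (2s) f (g s) ds`. -/
noncomputable def radialMean (T : ℝ) (f g : ℝ → ℝ) (t : ℝ) : ℝ :=
  ∫ τ in (0 : ℝ)..1, sincKernel T t τ * f (g (t * τ))

/-- The Volterra operator whose fixed points `g` solve
`(sin (2t) g')' + L sin (2t) f g = 0`, `g 0 = d`, `g' 0 = 0`. -/
noncomputable def radialVolterra (T L : ℝ) (f g : ℝ → ℝ) (d θ : ℝ) : ℝ :=
  d - L * ∫ t in (0 : ℝ)..θ, t * radialMean T f g t

theorem continuous_radialMean {X : Type*} [TopologicalSpace X] {T : ℝ} (hT : 0 < T)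
    (hT' : T < Real.pi / 2) {f : ℝ → ℝ} (hf : Continuous f) {g : X → ℝ → ℝ}
    (hg : Continuous fun p : X × ℝ => g p.1 p.2) :
    Continuous fun p : X × ℝ => radialMean T f (g p.1) p.2 := by
  unfold radialMean
  have hk := continuous_sincKernel hT hT'
  apply intervalIntegral.continuous_parametric_intervalIntegral_of_continuous'
  refine Continuous.mul (hk.comp (by fun_prop : Continuous fun q : (X × ℝ) × ℝ => (q.1.2, q.2)))
    (hf.comp (hg.comp (by fun_prop :
      Continuous fun q : (X × ℝ) × ℝ => (q.1.1, q.1.2 * q.2))))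

theorem continuous_radialMean_single {T : ℝ} (hT : 0 < T)
    (hT' : T < Real.pi / 2) {f : ℝ → ℝ} (hf : Continuous f) {g : ℝ → ℝ}
    (hg : Continuous g) : Continuous (radialMean T f g) := by
  have := continuous_radialMean (X := Unit) hT hT' hf (g := fun _ => g)
    (hg.comp continuous_snd)
  exact this.comp (by fun_prop : Continuous fun t : ℝ => (((), t) : Unit × ℝ))

theorem hasDerivAt_radialVolterra {T : ℝ} (hT : 0 < T)
    (hT' : T < Real.pi / 2) {f : ℝ → ℝ} (hf : Continuous f) {g : ℝ → ℝ}
    (hg : Continuous g) (L d θ : ℝ) :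
    HasDerivAt (radialVolterra T L f g d) (-L * (θ * radialMean T f g θ)) θ := by
  have hc : Continuous fun t => t * radialMean T f g t :=
    continuous_id.mul (continuous_radialMean_single hT hT' hf hg)
  have := ((hc.integral_hasStrictDerivAt 0 θ).hasDerivAt.const_mul L).const_sub d
  rw [neg_mul]
  exact this

theorem sin_mul_radialMean {T : ℝ} {f g : ℝ → ℝ} {t : ℝ} (ht : t ∈ Ioc 0 T)
    (hT' : T < Real.pi / 2) :
    t * radialMean T f g t =
      (Real.sin (2 * t))⁻¹ * ∫ s in (0 : ℝ)..t, Real.sin (2 * s) * f (g s) := by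
  obtain ⟨h0, h1⟩ := ht
  have hs : 0 < Real.sin (2 * t) := Real.sin_pos_of_pos_of_lt_pi (by linarith) (by linarith)
  have key : ∀ τ : ℝ, sincKernel T t τ * f (g (t * τ))
      = (Real.sin (2 * t))⁻¹ * (Real.sin (2 * (t * τ)) * f (g (t * τ))) := by
    intro τ
    have : sincKernel T t τ = (Real.sin (2 * t))⁻¹ * Real.sin (2 * (t * τ)) := by
      unfold sincKernel
      rw [clampTo_of_mem ⟨h0.le, h1⟩, ← Real.mul_sinc (2 * (t * τ)), ← Real.mul_sinc (2 * t),
        ← mul_assoc 2 t τ]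
      have : Real.sinc (2 * t) ≠ 0 := (Real.sinc_pos_of_abs_lt_pi
        (by rw [abs_of_nonneg] <;> linarith)).ne'
      field_simp
    rw [this]; ring
  unfold radialMean
  simp_rw [key]
  rw [intervalIntegral.integral_const_mul, mul_left_comm]
  congr 1
  have := intervalIntegral.smul_integral_comp_mul_left (a := 0) (b := 1)
    (fun s => Real.sin (2 * s) * f (g s)) t
  simpa using this

theorem radialMean_zero {T : ℝ} (hT : 0 < T) (f g : ℝ → ℝ) : radialMean T f g 0 = f (g 0) / 2 := by
  have : clampTo T 0 = 0 := clampTo_of_mem ⟨le_rfl, hT.le⟩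
  simp only [radialMean, sincKernel, this, zero_mul, mul_zero, Real.sinc_zero, mul_one, div_one]
  rw [intervalIntegral.integral_mul_const, integral_id]
  ring

/-- The derivative of `t * radialMean T f g t`; the formula covers `t = 0`, where the two terms
are `f (g 0)` and `f (g 0) / 2`. -/
theorem hasDerivAt_mul_radialMean {T : ℝ} (hT : 0 < T)
    (hT' : T < Real.pi / 2) {f : ℝ → ℝ} (hf : Continuous f) {g : ℝ → ℝ}
    (hg : Continuous g) {t : ℝ} (ht : t ∈ Ico 0 T) :
    HasDerivAt (fun t => t * radialMean T f g t)
      (f (g t) - Real.cos (2 * t) / Real.sinc (2 * clampTo T t) * radialMean T f g t) t := by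
  rcases eq_or_lt_of_le ht.1 with h0 | h0
  · subst h0
    have e : f (g 0) - Real.cos (2 * 0) / Real.sinc (2 * clampTo T 0) * radialMean T f g 0
        = radialMean T f g 0 := by
      rw [radialMean_zero hT, clampTo_of_mem ⟨le_rfl, hT.le⟩]; simp; ring
    rw [e, hasDerivAt_iff_tendsto_slope]
    have hc := (continuous_radialMean_single hT hT' hf hg).tendsto 0
    refine (hc.mono_left nhdsWithin_le_nhds).congr' ?_
    filter_upwards [self_mem_nhdsWithin] with x hx
    have hx : x ≠ 0 := hx
    simp [slope, hx]
  · have hs : 0 < Real.sin (2 * t) :=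
      Real.sin_pos_of_pos_of_lt_pi (by linarith) (by linarith [ht.2])
    have hc : Continuous fun s => Real.sin (2 * s) * f (g s) := by fun_prop
    have h1 := (hc.integral_hasStrictDerivAt 0 t).hasDerivAt
    have h2 : HasDerivAt (fun t => (Real.sin (2 * t))⁻¹)
        (-(Real.cos (2 * t) * 2) / Real.sin (2 * t) ^ 2) t := by
      have h3 : HasDerivAt (fun t : ℝ => 2 * t) 2 t := by
        simpa using (hasDerivAt_id t).const_mul 2
      exact (h3.sin).inv hs.ne'
    have h4 := h2.mul h1
    have h5 : (fun t => t * radialMean T f g t) =ᶠ[𝓝 t] (fun t => (Real.sin (2 * t))⁻¹) *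
        fun t => ∫ s in (0 : ℝ)..t, Real.sin (2 * s) * f (g s) := by
      filter_upwards [Ioo_mem_nhds h0 ht.2] with x hx
      exact sin_mul_radialMean ⟨hx.1, hx.2.le⟩ hT'
    refine (h4.congr_of_eventuallyEq h5).congr_deriv ?_
    have h6 := sin_mul_radialMean (f := f) (g := g) ⟨h0, ht.2.le⟩ hT'
    have h7 : (∫ s in (0 : ℝ)..t, Real.sin (2 * s) * f (g s))
        = Real.sin (2 * t) * (t * radialMean T f g t) := by
      rw [h6]; field_simp
    rw [h7, clampTo_of_mem ⟨h0.le, ht.2.le⟩, Real.sinc_of_ne_zero (by linarith)]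
    field_simp
    ring

theorem exists_sincKernel_bound {T : ℝ} (hT : 0 < T) (hT' : T < Real.pi / 2) :
    ∃ C, 0 < C ∧ ∀ t ∈ Icc 0 T, ∀ τ ∈ Icc (0 : ℝ) 1, |sincKernel T t τ| ≤ C := by
  obtain ⟨C, hC⟩ := (isCompact_Icc.prod isCompact_Icc : IsCompact (Icc 0 T ×ˢ Icc (0 : ℝ) 1))
    |>.exists_bound_of_continuousOn (continuous_sincKernel hT hT').continuousOn
  exact ⟨max C 1, by positivity, fun t ht τ hτ => (hC (t, τ) ⟨ht, hτ⟩).trans (le_max_left _ _)⟩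

/-- The Volterra operator contracts in the exponentially weighted norm
`sup |g t| exp (-a t)` once `a` is large. -/
theorem radialVolterra_sub_le {T : ℝ} (hT : 0 < T) (hT' : T < Real.pi / 2) {f : ℝ → ℝ}
    {l : NNReal} (hf : LipschitzWith l f) {C : ℝ} (hC0 : 0 < C)
    (hC : ∀ t ∈ Icc 0 T, ∀ τ ∈ Icc (0 : ℝ) 1, |sincKernel T t τ| ≤ C) (L : ℝ) {a : ℝ} (ha : 0 < a)
    {g h : ℝ → ℝ} (hg : Continuous g) (hh : Continuous h) {D : ℝ} (hD : 0 ≤ D)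
    (hgh : ∀ t ∈ Icc 0 T, |g t - h t| ≤ D * Real.exp (a * t)) (d : ℝ) {θ : ℝ}
    (hθ : θ ∈ Icc 0 T) :
    |radialVolterra T L f g d θ - radialVolterra T L f h d θ|
      ≤ |L| * l * C * T / a * (D * Real.exp (a * θ)) := by
  have hm : ∀ t ∈ Icc 0 T, |radialMean T f g t - radialMean T f h t|
      ≤ C * (l * (D * Real.exp (a * t))) := by
    intro t ht
    unfold radialMean
    have hk : Continuous (sincKernel T t) := (continuous_sincKernel hT hT').comp
      (by fun_prop : Continuous fun τ : ℝ => (t, τ))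
    have hf' := hf.continuous
    have hi : ∀ q : ℝ → ℝ, Continuous q → IntervalIntegrable
        (fun τ => sincKernel T t τ * f (q (t * τ))) MeasureTheory.volume 0 1 :=
      fun q hq => (by fun_prop : Continuous fun τ => sincKernel T t τ * f (q (t * τ)))
        |>.intervalIntegrable _ _
    rw [← intervalIntegral.integral_sub (hi g hg) (hi h hh)]
    have := intervalIntegral.norm_integral_le_of_norm_le_const (a := 0) (b := 1)
      (f := fun τ => sincKernel T t τ * f (g (t * τ)) - sincKernel T t τ * f (h (t * τ)))
      (C := C * (l * (D * Real.exp (a * t)))) ?_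
    · simpa using this
    intro τ hτ
    rw [uIoc_of_le zero_le_one] at hτ
    have h1 : t * τ ∈ Icc 0 T :=
      ⟨mul_nonneg ht.1 hτ.1.le, (mul_le_of_le_one_right ht.1 hτ.2).trans ht.2⟩
    rw [← mul_sub, norm_mul]
    refine mul_le_mul (hC t ht τ ⟨hτ.1.le, hτ.2⟩) ?_ (norm_nonneg _) hC0.le
    refine (hf.norm_sub_le _ _).trans ?_
    gcongr
    refine (hgh _ h1).trans ?_
    gcongr
    exact mul_le_of_le_one_right ht.1 hτ.2
  have hcg := continuous_radialMean_single hT hT' hf.continuous hg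
  have hch := continuous_radialMean_single hT hT' hf.continuous hh
  have e : radialVolterra T L f g d θ - radialVolterra T L f h d θ
      = -L * ∫ t in (0 : ℝ)..θ, t * (radialMean T f g t - radialMean T f h t) := by
    unfold radialVolterra
    have hi : ∀ q : ℝ → ℝ, Continuous q → IntervalIntegrable
        (fun t => t * q t) MeasureTheory.volume 0 θ :=
      fun q hq => (continuous_id.mul hq).intervalIntegrable _ _
    simp_rw [mul_sub]
    rw [intervalIntegral.integral_sub (hi _ hcg) (hi _ hch)]
    ring
  have hI : |∫ t in (0 : ℝ)..θ, t * (radialMean T f g t - radialMean T f h t)|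
      ≤ ∫ t in (0 : ℝ)..θ, T * (C * (l * (D * Real.exp (a * t)))) := by
    have hi : IntervalIntegrable (fun t => T * (C * (l * (D * Real.exp (a * t)))))
        MeasureTheory.volume 0 θ := Continuous.intervalIntegrable (by fun_prop) _ _
    rw [← Real.norm_eq_abs]
    refine intervalIntegral.norm_integral_le_of_norm_le hθ.1 (Eventually.of_forall ?_) hi
    intro t ht
    rw [norm_mul, Real.norm_of_nonneg ht.1.le]
    exact mul_le_mul (ht.2.trans hθ.2) (hm t ⟨ht.1.le, ht.2.trans hθ.2⟩) (norm_nonneg _) hT.le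
  have hE : ∫ t in (0 : ℝ)..θ, T * (C * (l * (D * Real.exp (a * t))))
      = T * (C * (l * (D * ((Real.exp (a * θ) - 1) / a)))) := by
    simp only [intervalIntegral.integral_const_mul]
    rw [intervalIntegral.integral_comp_mul_left (fun x => Real.exp x) ha.ne', integral_exp]
    simp [div_eq_inv_mul]
  rw [e, abs_mul, abs_neg]
  calc _ ≤ |L| * (T * (C * (l * (D * ((Real.exp (a * θ) - 1) / a))))) := by
        rw [← hE]; gcongr
    _ ≤ |L| * (T * (C * (l * (D * ((Real.exp (a * θ)) / a))))) := by gcongr; linarith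
    _ = _ := by ring

/-- A solution of `u'' + 2 cot (2t) u' + L f u = 0`, `u 0 = d`, `u' 0 = 0`: position
`u`, velocity `v` and acceleration `a` on `[0, T)`. -/
structure IsShot (f : ℝ → ℝ) (L T d : ℝ) (u v a : ℝ → ℝ) : Prop where
  u_zero : u 0 = d
  v_zero : v 0 = 0
  a_zero : a 0 = -L * f d / 2
  hasDerivAt_u : ∀ t ∈ Ico 0 T, HasDerivAt u (v t) t
  hasDerivAt_v : ∀ t ∈ Ico 0 T, HasDerivAt v (a t) t
  ode : ∀ t ∈ Ioo 0 T, a t = -L * f (u t) - 2 * (Real.cos (2 * t) / Real.sin (2 * t)) * v t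

/-- A fixed point of the Volterra operator is a solution of the singular initial value problem. -/
theorem isShot_of_fixed {T : ℝ} (hT : 0 < T) (hT' : T < Real.pi / 2) {f : ℝ → ℝ}
    (hf : Continuous f) {L d : ℝ} {g : ℝ → ℝ} (hg : Continuous g)
    (hfix : ∀ t ∈ Icc 0 T, g t = radialVolterra T L f g d t) :
    IsShot f L T d (radialVolterra T L f g d) (fun t => -L * (t * radialMean T f g t))
      (fun t => -L * (f (radialVolterra T L f g d t) -
        Real.cos (2 * t) / Real.sinc (2 * clampTo T t) * radialMean T f g t)) := by
  have h0 : radialVolterra T L f g d 0 = d := by simp [radialVolterra]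
  have hg0 : g 0 = d := by rw [hfix 0 ⟨le_rfl, hT.le⟩, h0]
  refine ⟨h0, by simp, ?_, fun t _ => hasDerivAt_radialVolterra hT hT' hf hg L d t, ?_, ?_⟩
  · rw [h0, radialMean_zero hT, clampTo_of_mem ⟨le_rfl, hT.le⟩, hg0]; simp; ring
  · intro t ht
    rw [← hfix t ⟨ht.1, ht.2.le⟩]
    exact (hasDerivAt_mul_radialMean hT hT' hf hg ht).const_mul (-L)
  · intro t ht
    have hs : 0 < Real.sin (2 * t) :=
      Real.sin_pos_of_pos_of_lt_pi (by linarith [ht.1]) (by linarith [ht.2])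
    have := ht.1
    rw [clampTo_of_mem ⟨ht.1.le, ht.2.le⟩, Real.sinc_of_ne_zero (by linarith [ht.1])]
    field_simp
    ring

/-- Global solvability of the singular initial value problem with a Lipschitz nonlinearity, with
joint continuity in the initial value `d` and the time, and constancy at the zeros of `f`. -/
theorem exists_shots {T : ℝ} (hT : 0 < T) (hT' : T < Real.pi / 2) {f : ℝ → ℝ}
    {l : NNReal} (hf : LipschitzWith l f) (L : ℝ) :
    ∃ U V A : ℝ → ℝ → ℝ, (Continuous fun p : ℝ × ℝ => U p.1 p.2) ∧
      (Continuous fun p : ℝ × ℝ => V p.1 p.2) ∧ (Continuous fun p : ℝ × ℝ => A p.1 p.2) ∧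
      (∀ d, IsShot f L T d (U d) (V d) (A d)) ∧
      ∀ c, f c = 0 → ∀ t ∈ Icc 0 T, U c t = c := by
  obtain ⟨C, hC0, hC⟩ := exists_sincKernel_bound hT hT'
  obtain ⟨a, ha, haK⟩ : ∃ a : ℝ, 0 < a ∧ |L| * l * C * T / a ≤ 1 / 2 := by
    refine ⟨2 * (|L| * l * C * T) + 1, by positivity, ?_⟩
    rw [div_le_iff₀ (by positivity)]; linarith
  -- `E w` undoes the exponential weight and extends to the real line.
  let E : C(Icc (0 : ℝ) T, ℝ) → ℝ → ℝ := fun w t => Real.exp (a * t) * w (projIcc 0 T hT.le t)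
  have hE2 : Continuous fun p : C(Icc (0 : ℝ) T, ℝ) × ℝ => E p.1 p.2 := by
    have : Continuous fun p : C(Icc (0 : ℝ) T, ℝ) × ℝ => p.1 (projIcc 0 T hT.le p.2) :=
      continuous_fst.eval ((continuous_projIcc (h := hT.le)).comp continuous_snd)
    exact (by fun_prop : Continuous fun p : C(Icc (0 : ℝ) T, ℝ) × ℝ =>
      Real.exp (a * p.2)).mul this
  have hE1 : ∀ w, Continuous (E w) := fun w =>
    hE2.comp (by fun_prop : Continuous fun t : ℝ => (w, t))
  have hVc : ∀ w d, Continuous (radialVolterra T L f (E w) d) := fun w d =>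
    continuous_iff_continuousAt.2 fun t =>
      (hasDerivAt_radialVolterra hT hT' hf.continuous (hE1 w) L d t).continuousAt
  let Φ : ℝ → C(Icc (0 : ℝ) T, ℝ) → C(Icc (0 : ℝ) T, ℝ) := fun d w =>
    ⟨fun t => Real.exp (-(a * t)) * radialVolterra T L f (E w) d t,
      (by fun_prop : Continuous fun t : Icc (0 : ℝ) T => Real.exp (-(a * (t : ℝ)))).mul
        ((hVc w d).comp continuous_subtype_val)⟩
  have hΦ : ∀ d, ContractingWith (1 / 2) (Φ d) := by
    intro d
    refine ⟨by norm_num, LipschitzWith.of_dist_le_mul fun w w' => ?_⟩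
    rw [ContinuousMap.dist_le (by positivity)]
    intro t
    have hD : ∀ s ∈ Icc 0 T, |E w s - E w' s| ≤ dist w w' * Real.exp (a * s) := by
      intro s hs
      simp only [E]
      rw [← mul_sub, abs_mul, abs_of_pos (Real.exp_pos _), mul_comm]
      gcongr
      exact ContinuousMap.dist_apply_le_dist (f := w) (g := w') _
    have := radialVolterra_sub_le hT hT' hf hC0 hC L ha (hE1 w) (hE1 w') dist_nonneg hD d t.2
    simp only [Φ, ContinuousMap.coe_mk, Real.dist_eq]
    rw [← mul_sub, abs_mul, abs_of_pos (Real.exp_pos _)]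
    calc _ ≤ Real.exp (-(a * t)) * (1 / 2 * (dist w w' * Real.exp (a * t))) := by
          gcongr
          refine this.trans ?_
          gcongr
      _ = 1 / 2 * dist w w' * (Real.exp (-(a * t)) * Real.exp (a * t)) := by ring
      _ = _ := by rw [← Real.exp_add]; simp
  let w : ℝ → C(Icc (0 : ℝ) T, ℝ) := fun d => (hΦ d).fixedPoint (Φ d)
  have hw : Continuous w := by
    have : LipschitzWith 2 w := by
      refine LipschitzWith.of_dist_le_mul fun d d' => ?_
      have := ContractingWith.fixedPoint_lipschitz_in_map (hΦ d) (hΦ d') (C := dist d d') ?_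
      · refine this.trans (le_of_eq ?_)
        push_cast; ring
      intro z
      rw [ContinuousMap.dist_le dist_nonneg]
      intro t
      simp only [Φ, ContinuousMap.coe_mk, Real.dist_eq]
      rw [← mul_sub, abs_mul, abs_of_pos (Real.exp_pos _)]
      have e : radialVolterra T L f (E z) d t - radialVolterra T L f (E z) d' t = d - d' := by
        unfold radialVolterra; ring
      rw [e]
      exact mul_le_of_le_one_left (abs_nonneg _)
        (Real.exp_le_one_iff.2 (by have := t.2.1; nlinarith))
    exact this.continuous
  have hfix : ∀ d, ∀ t ∈ Icc 0 T, E (w d) t = radialVolterra T L f (E (w d)) d t := by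
    intro d t ht
    have h1 : Φ d (w d) = w d := (hΦ d).fixedPoint_isFixedPt
    have h2 := congrArg (fun z : C(Icc (0 : ℝ) T, ℝ) => z ⟨t, ht⟩) h1
    simp only [Φ, ContinuousMap.coe_mk] at h2
    simp only [E] at h2 ⊢
    rw [projIcc_of_mem hT.le ht, ← h2, ← mul_assoc, ← Real.exp_add]
    simp
  have hg : Continuous fun p : ℝ × ℝ => E (w p.1) p.2 :=
    hE2.comp ((hw.comp continuous_fst).prodMk continuous_snd)
  have hM := continuous_radialMean hT hT' hf.continuous (g := fun d => E (w d)) hg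
  have hU : Continuous fun p : ℝ × ℝ => radialVolterra T L f (E (w p.1)) p.1 p.2 := by
    unfold radialVolterra
    refine continuous_fst.sub (continuous_const.mul ?_)
    refine intervalIntegral.continuous_parametric_intervalIntegral_of_continuous
      (f := fun (p : ℝ × ℝ) t => t * radialMean T f (E (w p.1)) t) ?_ continuous_snd
    exact continuous_snd.mul (hM.comp (by fun_prop :
      Continuous fun q : (ℝ × ℝ) × ℝ => (q.1.1, q.2)))
  have hf' := hf.continuous
  refine ⟨fun d => radialVolterra T L f (E (w d)) d,
    fun d t => -L * (t * radialMean T f (E (w d)) t),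
    fun d t => -L * (f (radialVolterra T L f (E (w d)) d t) -
        Real.cos (2 * t) / Real.sinc (2 * clampTo T t) * radialMean T f (E (w d)) t), hU,
    continuous_const.mul (continuous_snd.mul hM), ?_,
    fun d => isShot_of_fixed hT hT' hf.continuous (hE1 _) (hfix d), ?_⟩
  · have h1 : Continuous fun p : ℝ × ℝ => Real.cos (2 * p.2) / Real.sinc (2 * clampTo T p.2) := by
      have h := Real.continuous_sinc
      have h2 := continuous_clampTo T
      exact Continuous.div (by fun_prop) (by fun_prop) fun p => (sinc_clampTo_pos hT hT' _).ne'
    exact continuous_const.mul ((hf'.comp hU).sub (h1.mul hM))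
  · intro c hc t ht
    let z : C(Icc (0 : ℝ) T, ℝ) := ⟨fun t => Real.exp (-(a * t)) * c, by fun_prop⟩
    have hz : ∀ s ∈ Icc 0 T, E z s = c := by
      intro s hs
      simp only [E, z, ContinuousMap.coe_mk]
      rw [projIcc_of_mem hT.le hs, ← mul_assoc, ← Real.exp_add]
      simp
    have hmean : ∀ s ∈ Icc 0 T, radialMean T f (E z) s = 0 := by
      intro s hs
      unfold radialMean
      rw [intervalIntegral.integral_congr (g := fun _ => 0)]
      · simp
      intro τ hτ
      rw [uIcc_of_le zero_le_one] at hτ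
      simp only
      rw [hz _ ⟨mul_nonneg hs.1 hτ.1, (mul_le_of_le_one_right hs.1 hτ.2).trans hs.2⟩, hc, mul_zero]
    have hv : ∀ s ∈ Icc 0 T, radialVolterra T L f (E z) c s = c := by
      intro s hs
      unfold radialVolterra
      rw [intervalIntegral.integral_congr (g := fun _ => 0)]
      · simp
      intro r hr
      rw [uIcc_of_le hs.1] at hr
      simp only
      rw [hmean r ⟨hr.1, hr.2.trans hs.2⟩, mul_zero]
    have hzfix : Φ c z = z := by
      ext s
      simp only [Φ, ContinuousMap.coe_mk, z]
      rw [hv s s.2]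
    have hzw : z = w c := (hΦ c).fixedPoint_unique hzfix
    exact (hfix c t ht).symm.trans (by rw [← hzw, hz t ht])

/-! ### Single solutions: the force, behaviour after a zero, energy -/

/-- A continuous function that is negative at `a` and nonnegative at `b` has a first zero. -/
theorem exists_first_zero {g : ℝ → ℝ} {a b : ℝ} (hab : a ≤ b) (hg : ContinuousOn g (Icc a b))
    (ha : g a < 0) (hb : 0 ≤ g b) :
    ∃ c ∈ Ioc a b, g c = 0 ∧ ∀ t ∈ Ico a c, g t < 0 := by
  have hcl : IsCompact (Icc a b ∩ g ⁻¹' Ici 0) :=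
    isCompact_Icc.of_isClosed_subset (hg.preimage_isClosed_of_isClosed isClosed_Icc isClosed_Ici)
      inter_subset_left
  obtain ⟨c, ⟨hc, hc0⟩, hmin⟩ := hcl.exists_isLeast ⟨b, ⟨hab, le_rfl⟩, hb⟩
  have hac : a < c := lt_of_le_of_ne hc.1 (by rintro rfl; exact absurd hc0 (not_le.2 ha))
  have hlt : ∀ t ∈ Ico a c, g t < 0 := by
    intro t ht
    by_contra hcon
    exact absurd (hmin ⟨⟨ht.1, ht.2.le.trans hc.2⟩, not_lt.1 hcon⟩) (not_le.2 ht.2)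
  refine ⟨c, ⟨hac, hc.2⟩, le_antisymm ?_ hc0, hlt⟩
  have hcont : Tendsto g (𝓝[Ico a c] c) (𝓝 (g c)) :=
    (hg c hc).mono_left (nhdsWithin_mono _ fun t ht => ⟨ht.1, ht.2.le.trans hc.2⟩)
  have : (𝓝[Ico a c] c).NeBot := by
    rw [nhdsWithin_Ico_eq_nhdsLT hac]; infer_instance
  exact le_of_tendsto hcont (eventually_nhdsWithin_of_forall fun t ht => (hlt t ht).le)

/-- The nonlinearity `x ^ 5 - x`, frozen below `0` and above `M`. It is globally Lipschitz, and
vanishes for `x ≤ 0`, so that a solution which becomes negative never turns back. -/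
noncomputable def toroForce (M x : ℝ) : ℝ := clampTo M x ^ 5 - clampTo M x

theorem toroForce_of_mem {M x : ℝ} (hx : x ∈ Icc 0 M) : toroForce M x = x ^ 5 - x := by
  rw [toroForce, clampTo_of_mem hx]

theorem toroForce_of_nonpos {M x : ℝ} (hx : x ≤ 0) : toroForce M x = 0 := by
  have : clampTo M x = 0 := max_eq_left ((min_le_left _ _).trans hx)
  simp [toroForce, this]

theorem toroForce_one {M : ℝ} (hM : 1 < M) : toroForce M 1 = 0 := by
  rw [toroForce_of_mem ⟨zero_le_one, hM.le⟩]; norm_num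

theorem lipschitzWith_clampTo (M : ℝ) : LipschitzWith 1 (clampTo M) := by
  have : LipschitzWith 1 fun x : ℝ => min x M := LipschitzWith.id.min_const M
  exact this.const_max 0

theorem lipschitzWith_toroForce {M : ℝ} (hM : 1 < M) :
    LipschitzWith (5 * M ^ 4 + 1).toNNReal (toroForce M) := by
  have hM0 : 0 ≤ M := by linarith
  refine LipschitzWith.of_dist_le_mul fun x y => ?_
  rw [Real.coe_toNNReal _ (by positivity)]
  have h1 := (lipschitzWith_clampTo M).dist_le_mul x y
  simp only [NNReal.coe_one, one_mul] at h1
  rw [Real.dist_eq] at h1 ⊢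
  obtain ⟨p0, pM⟩ := clampTo_mem hM0 x
  obtain ⟨q0, qM⟩ := clampTo_mem hM0 y
  unfold toroForce
  set p := clampTo M x
  set q := clampTo M y
  have e : p ^ 5 - p - (q ^ 5 - q)
      = (p - q) * (p ^ 4 + p ^ 3 * q + p ^ 2 * q ^ 2 + p * q ^ 3 + q ^ 4 - 1) := by ring
  have h4 : p ^ 4 + p ^ 3 * q + p ^ 2 * q ^ 2 + p * q ^ 3 + q ^ 4
      ≤ M ^ 4 + M ^ 3 * M + M ^ 2 * M ^ 2 + M * M ^ 3 + M ^ 4 := by gcongr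
  have h5 : 0 ≤ p ^ 4 + p ^ 3 * q + p ^ 2 * q ^ 2 + p * q ^ 3 + q ^ 4 := by positivity
  rw [e, abs_mul, mul_comm]
  refine mul_le_mul (abs_le.2 ⟨?_, ?_⟩) h1 (abs_nonneg _) (by positivity)
  · nlinarith [pow_nonneg hM0 4]
  · nlinarith

theorem toroForce_mul_sub_one_pos {M x : ℝ} (hM : 1 < M) (hx : 0 < x) (hx1 : x ≠ 1) :
    0 < toroForce M x * (x - 1) := by
  rcases lt_or_gt_of_ne hx1 with h | h
  · rw [toroForce_of_mem ⟨hx.le, by linarith⟩]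
    have : x ^ 5 < x := by
      simpa using pow_lt_pow_right_of_lt_one₀ hx h (show 1 < 5 by norm_num)
    nlinarith
  · have hp : 1 < clampTo M x := lt_max_of_lt_right (lt_min h hM)
    have : clampTo M x < clampTo M x ^ 5 := by
      simpa using pow_lt_pow_right₀ hp (show 1 < 5 by norm_num)
    exact mul_pos (by unfold toroForce; linarith) (by linarith)

/-- The potential of `toroForce M`, normalized to vanish at the equilibrium `1`. -/
noncomputable def toroPotential (M x : ℝ) : ℝ := ∫ s in (1 : ℝ)..x, toroForce M s

theorem hasDerivAt_toroPotential {M : ℝ} (hM : 1 < M) (x : ℝ) :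
    HasDerivAt (toroPotential M) (toroForce M x) x :=
  ((lipschitzWith_toroForce hM).continuous.integral_hasStrictDerivAt 1 x).hasDerivAt

theorem toroPotential_of_mem {M x : ℝ} (hM : 1 < M) (hx : x ∈ Icc 0 M) :
    toroPotential M x = x ^ 6 / 6 - x ^ 2 / 2 + 1 / 3 := by
  unfold toroPotential
  rw [intervalIntegral.integral_congr (g := fun s => s ^ 5 - s)]
  · rw [intervalIntegral.integral_sub (by simp) (by simp), integral_pow, integral_id]
    norm_num; ring
  · intro s hs
    exact toroForce_of_mem (uIcc_subset_Icc ⟨zero_le_one, hM.le⟩ hx hs)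

theorem toroPotential_nonneg {M : ℝ} (hM : 1 < M) (x : ℝ) : 0 ≤ toroPotential M x := by
  have hc : Continuous (toroPotential M) :=
    continuous_iff_continuousAt.2 fun t => (hasDerivAt_toroPotential hM t).continuousAt
  have h1 : toroPotential M 1 = 0 := by simp [toroPotential]
  rw [← h1]
  rcases le_total 1 x with h | h
  · refine monotoneOn_of_deriv_nonneg (convex_Ici 1) hc.continuousOn
      (fun t _ => (hasDerivAt_toroPotential hM t).differentiableAt.differentiableWithinAt) ?_
      self_mem_Ici h h
    intro t ht
    rw [interior_Ici] at ht
    have ht : 1 < t := ht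
    rw [(hasDerivAt_toroPotential hM t).deriv]
    exact (pos_of_mul_pos_left (toroForce_mul_sub_one_pos hM (by linarith) ht.ne')
      (by linarith)).le
  · refine antitoneOn_of_deriv_nonpos (convex_Iic 1) hc.continuousOn
      (fun t _ => (hasDerivAt_toroPotential hM t).differentiableAt.differentiableWithinAt) ?_
      h self_mem_Iic h
    intro t ht
    rw [interior_Iic] at ht
    have ht : t < 1 := ht
    rw [(hasDerivAt_toroPotential hM t).deriv]
    rcases le_or_gt t 0 with h0 | h0
    · rw [toroForce_of_nonpos h0]
    · nlinarith [toroForce_mul_sub_one_pos hM h0 ht.ne]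

section Shot

variable {f : ℝ → ℝ} {L T d M : ℝ} {u v a : ℝ → ℝ}

theorem sin_two_mul_pos {T : ℝ} (hT' : T < Real.pi / 2) {t : ℝ} (ht : t ∈ Ioo 0 T) :
    0 < Real.sin (2 * t) :=
  Real.sin_pos_of_pos_of_lt_pi (by linarith [ht.1]) (by linarith [ht.2])

theorem IsShot.continuousOn_u (h : IsShot f L T d u v a) : ContinuousOn u (Ico 0 T) :=
  fun t ht => (h.hasDerivAt_u t ht).continuousAt.continuousWithinAt

theorem IsShot.continuousOn_v (h : IsShot f L T d u v a) : ContinuousOn v (Ico 0 T) :=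
  fun t ht => (h.hasDerivAt_v t ht).continuousAt.continuousWithinAt

/-- Backward uniqueness at an equilibrium `c`, by Grönwall for `(u - c) ^ 2 + v ^ 2`. -/
theorem IsShot.eq_of_equilibrium (h : IsShot f L T d u v a) (hT' : T < Real.pi / 2)
    {l : NNReal} (hf : LipschitzWith l f) {c z : ℝ} (hc : f c = 0) (hz : z ∈ Ico 0 T)
    (huz : u z = c) (hvz : v z = 0) : d = c := by
  rcases eq_or_lt_of_le hz.1 with h0 | h0
  · rw [← h.u_zero, ← huz, h0]
  have key : ∀ ε ∈ Ioo 0 z, u ε = c := by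
    intro ε hε
    have hsub : Icc ε z ⊆ Ioo 0 T := fun t ht => ⟨hε.1.trans_le ht.1, ht.2.trans_lt hz.2⟩
    obtain ⟨B, hB⟩ := isCompact_Icc.exists_bound_of_continuousOn (s := Icc ε z)
      (f := fun t => 2 * (Real.cos (2 * t) / Real.sin (2 * t)))
      (continuousOn_const.mul (ContinuousOn.div (by fun_prop) (by fun_prop)
        fun t ht => (sin_two_mul_pos hT' (hsub ht)).ne'))
    set K := 1 + |L| * l + 2 * B with hK
    have hd : ∀ t ∈ Ioo 0 T, HasDerivAt (fun t => ((u t - c) ^ 2 + v t ^ 2) * Real.exp (K * t))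
        ((2 * (u t - c) * v t + 2 * v t * a t) * Real.exp (K * t)
          + ((u t - c) ^ 2 + v t ^ 2) * (Real.exp (K * t) * K)) t := by
      intro t ht
      have h1 := ((h.hasDerivAt_u t ⟨ht.1.le, ht.2⟩).sub_const c).pow 2
      have h2 := (h.hasDerivAt_v t ⟨ht.1.le, ht.2⟩).pow 2
      have h3 : HasDerivAt (fun t => Real.exp (K * t)) (Real.exp (K * t) * K) t := by
        have : HasDerivAt (fun t : ℝ => K * t) K t := by simpa using (hasDerivAt_id t).const_mul K
        exact this.exp
      refine ((h1.add h2).mul h3).congr_deriv ?_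
      simp
    have hmono := monotoneOn_of_deriv_nonneg (convex_Icc ε z)
      (f := fun t => ((u t - c) ^ 2 + v t ^ 2) * Real.exp (K * t))
      (fun t ht => (hd t (hsub ht)).continuousAt.continuousWithinAt)
      (fun t ht => (hd t (hsub (interior_subset ht))).differentiableAt.differentiableWithinAt) ?_
    · have := hmono ⟨le_rfl, hε.2.le⟩ ⟨hε.2.le, le_rfl⟩ hε.2.le
      simp only [huz, hvz] at this
      have h1 : ((u ε - c) ^ 2 + v ε ^ 2) * Real.exp (K * ε) ≤ 0 := by simpa using this
      have h2 : (u ε - c) ^ 2 + v ε ^ 2 ≤ 0 := nonpos_of_mul_nonpos_left h1 (Real.exp_pos _)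
      nlinarith [sq_nonneg (u ε - c), sq_nonneg (v ε)]
    · intro t ht
      have ht' := interior_subset ht
      rw [(hd t (hsub ht')).deriv, h.ode t (hsub ht')]
      have hf1 : |f (u t)| ≤ l * |u t - c| := by
        have := hf.dist_le_mul (u t) c
        simpa [Real.dist_eq, hc] using this
      have hB1 := hB t ht'
      simp only [Real.norm_eq_abs] at hB1
      set q := 2 * (Real.cos (2 * t) / Real.sin (2 * t))
      have e1 : -(2 * v t * (L * f (u t))) ≥ -(|L| * l * ((u t - c) ^ 2 + v t ^ 2)) := by
        have : |v t * (L * f (u t))| ≤ |v t| * (|L| * (l * |u t - c|)) := by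
          rw [abs_mul, abs_mul]; gcongr
        have h2 := le_abs_self (v t * (L * f (u t)))
        have h3 : 2 * (|v t| * |u t - c|) ≤ (u t - c) ^ 2 + v t ^ 2 := by
          rw [← sq_abs (u t - c), ← sq_abs (v t)]
          nlinarith [sq_nonneg (|u t - c| - |v t|)]
        have h4 := mul_le_mul_of_nonneg_left h3 (mul_nonneg (abs_nonneg L) l.2)
        simp only [NNReal.val_eq_coe] at h4
        nlinarith
      have e2 : -(2 * (q * v t ^ 2)) ≥ -(2 * B * ((u t - c) ^ 2 + v t ^ 2)) := by
        have hq := (abs_le.1 hB1).2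
        have hB0 : 0 ≤ B := (abs_nonneg _).trans hB1
        nlinarith [sq_nonneg (v t), sq_nonneg (u t - c)]
      have e3 : 2 * (u t - c) * v t ≥ -((u t - c) ^ 2 + v t ^ 2) := by
        nlinarith [sq_nonneg (u t - c + v t)]
      have : 0 ≤ (2 * (u t - c) * v t + 2 * v t * (-L * f (u t) - q * v t)
          + ((u t - c) ^ 2 + v t ^ 2) * K) := by
        rw [hK]; nlinarith
      have h2 := mul_nonneg this (Real.exp_pos (K * t)).le
      linarith
  have hlim : Tendsto u (𝓝[>] 0) (𝓝 d) := by
    rw [← h.u_zero]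
    exact (h.hasDerivAt_u 0 ⟨le_rfl, h0.trans hz.2⟩).continuousAt.tendsto.mono_left
      nhdsWithin_le_nhds
  have hlim2 : Tendsto u (𝓝[>] 0) (𝓝 c) := by
    refine tendsto_const_nhds.congr' ?_
    filter_upwards [Ioo_mem_nhdsGT h0] with t ht
    exact (key t ht).symm
  exact tendsto_nhds_unique hlim hlim2

theorem IsShot.denominator_pos (h : IsShot (toroForce M) L T d u v a) (hT' : T < Real.pi / 2)
    (hM : 1 < M) (hd : d ≠ 1) {ω : ℝ} (hω : 0 < ω) {t : ℝ} (ht : t ∈ Ico 0 T) :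
    0 < ω ^ 2 * (u t - 1) ^ 2 + v t ^ 2 := by
  by_contra hcon
  have h1 : v t ^ 2 = 0 := by
    nlinarith [sq_nonneg (v t), mul_nonneg (sq_nonneg ω) (sq_nonneg (u t - 1))]
  have h2 : ω ^ 2 * (u t - 1) ^ 2 = 0 := by
    nlinarith [sq_nonneg (v t), mul_nonneg (sq_nonneg ω) (sq_nonneg (u t - 1))]
  have h3 : u t - 1 = 0 := by
    rcases mul_eq_zero.1 h2 with h | h
    · exact absurd h (by positivity)
    · exact pow_eq_zero_iff (two_ne_zero) |>.1 h
  exact hd (h.eq_of_equilibrium hT' (lipschitzWith_toroForce hM) (toroForce_one hM) ht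
    (by linarith) (pow_eq_zero_iff two_ne_zero |>.1 h1))

/-- Once the solution has reached `0` it keeps decreasing: at the first zero `v < 0`, and beyond
it `sin (2t) v` is constant as long as `v < 0`, because the force vanishes. -/
theorem IsShot.v_neg_of_nonpos (h : IsShot (toroForce M) L T d u v a) (hT' : T < Real.pi / 2)
    (hM : 1 < M) (hd : 0 < d) {z : ℝ} (hz : z ∈ Ico 0 T) (huz : u z ≤ 0) :
    ∀ y ∈ Ico z T, v y < 0 := by
  have hcu := h.continuousOn_u
  obtain ⟨z₀, hz₀, hu0, hpos⟩ := exists_first_zero (g := fun t => -u t) hz.1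
    (hcu.neg.mono fun t ht => ⟨ht.1, ht.2.trans_lt hz.2⟩)
    (by rw [h.u_zero]; linarith) (by linarith)
  have hu0 : u z₀ = 0 := by simpa using hu0
  have hz₀T : z₀ < T := hz₀.2.trans_lt hz.2
  have hv0 : v z₀ < 0 := by
    refine lt_of_le_of_ne ?_ fun hv => hd.ne' <| h.eq_of_equilibrium hT'
      (lipschitzWith_toroForce hM) (toroForce_of_nonpos le_rfl) ⟨hz₀.1.le, hz₀T⟩ hu0 hv
    have hder := (h.hasDerivAt_u z₀ ⟨hz₀.1.le, hz₀T⟩)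
    have h1 := hder.tendsto_slope.mono_left (nhdsWithin_mono z₀
      (show Iio z₀ ⊆ {z₀}ᶜ from fun t (ht : t < z₀) => ht.ne))
    refine le_of_tendsto h1 ?_
    filter_upwards [Ioo_mem_nhdsLT hz₀.1] with t ht
    rw [slope_def_field, hu0]
    exact div_nonpos_of_nonneg_of_nonpos (by linarith [hpos t ⟨ht.1.le, ht.2⟩])
      (by linarith [ht.2])
  have hall : ∀ y ∈ Ico z₀ T, v y < 0 := by
    intro y hy
    by_contra hcon
    have hIcc : Icc z₀ y ⊆ Ico 0 T := fun t ht => ⟨hz₀.1.le.trans ht.1, ht.2.trans_lt hy.2⟩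
    obtain ⟨y₀, hy₀, hv1, hneg⟩ := exists_first_zero hy.1 (h.continuousOn_v.mono hIcc) hv0
      (not_lt.1 hcon)
    have hIcc' : Icc z₀ y₀ ⊆ Ico 0 T := (Icc_subset_Icc_right hy₀.2).trans hIcc
    have hanti : AntitoneOn u (Icc z₀ y₀) := by
      refine antitoneOn_of_deriv_nonpos (convex_Icc _ _) (hcu.mono hIcc')
        (fun t ht => (h.hasDerivAt_u t (hIcc' (interior_subset ht))).differentiableAt
          |>.differentiableWithinAt) fun t ht => ?_
      rw [(h.hasDerivAt_u t (hIcc' (interior_subset ht))).deriv]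
      rw [interior_Icc] at ht
      exact (hneg t ⟨ht.1.le, ht.2⟩).le
    have hconst : ∀ t ∈ Icc z₀ y₀, HasDerivAt (fun t => Real.sin (2 * t) * v t) 0 t := by
      intro t ht
      have ht' : t ∈ Ioo 0 T := ⟨hz₀.1.trans_le ht.1, (hIcc' ht).2⟩
      have hu : u t ≤ 0 := hu0 ▸ hanti ⟨le_rfl, hy₀.1.le⟩ ht ht.1
      have h3 : HasDerivAt (fun t : ℝ => 2 * t) 2 t := by
        simpa using (hasDerivAt_id t).const_mul 2
      refine (h3.sin.mul (h.hasDerivAt_v t (hIcc' ht))).congr_deriv ?_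
      rw [h.ode t ht', toroForce_of_nonpos hu]
      have := (sin_two_mul_pos hT' ht').ne'
      field_simp
      ring
    have hmono := monotoneOn_of_deriv_nonneg (convex_Icc z₀ y₀)
      (fun t ht => (hconst t ht).continuousAt.continuousWithinAt)
      (fun t ht => (hconst t (interior_subset ht)).differentiableAt.differentiableWithinAt)
      (fun t ht => (hconst t (interior_subset ht)).deriv.ge)
    have hanti2 := antitoneOn_of_deriv_nonpos (convex_Icc z₀ y₀)
      (fun t ht => (hconst t ht).continuousAt.continuousWithinAt)
      (fun t ht => (hconst t (interior_subset ht)).differentiableAt.differentiableWithinAt)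
      (fun t ht => (hconst t (interior_subset ht)).deriv.le)
    have h5 := hanti2 ⟨le_rfl, hy₀.1.le⟩ ⟨hy₀.1.le, le_rfl⟩ hy₀.1.le
    simp only [hv1, mul_zero] at h5
    have := sin_two_mul_pos hT' ⟨hz₀.1, hz₀T⟩
    nlinarith
  exact fun y hy => hall y ⟨hz₀.2.trans hy.1, hy.2⟩

theorem IsShot.antitoneOn_of_v_nonpos (h : IsShot f L T d u v a) {p q : ℝ} (hp : 0 ≤ p)
    (hq : q < T) (hv : ∀ t ∈ Ioo p q, v t ≤ 0) : AntitoneOn u (Icc p q) := by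
  have hsub : Icc p q ⊆ Ico 0 T := fun t ht => ⟨hp.trans ht.1, ht.2.trans_lt hq⟩
  refine antitoneOn_of_deriv_nonpos (convex_Icc _ _) (h.continuousOn_u.mono hsub)
    (fun t ht => (h.hasDerivAt_u t (hsub (interior_subset ht))).differentiableAt
      |>.differentiableWithinAt) fun t ht => ?_
  rw [(h.hasDerivAt_u t (hsub (interior_subset ht))).deriv]
  rw [interior_Icc] at ht
  exact hv t ht

/-- The energy `v² / 2 + L W(u)`, with `W` the potential of the force. It decreases before `π / 4`
and increases afterwards. -/
noncomputable def shotEnergy (M L : ℝ) (u v : ℝ → ℝ) (t : ℝ) : ℝ :=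
  v t ^ 2 / 2 + L * toroPotential M (u t)

theorem IsShot.hasDerivAt_energy (h : IsShot (toroForce M) L T d u v a) (hM : 1 < M) {t : ℝ}
    (ht : t ∈ Ico 0 T) :
    HasDerivAt (shotEnergy M L u v) (v t * (a t + L * toroForce M (u t))) t := by
  have h1 := ((h.hasDerivAt_v t ht).pow 2).div_const 2
  have h2 := ((hasDerivAt_toroPotential hM (u t)).comp t (h.hasDerivAt_u t ht)).const_mul L
  refine (h1.add h2).congr_deriv ?_
  simp; ring

theorem IsShot.hasDerivAt_energy' (h : IsShot (toroForce M) L T d u v a) (hM : 1 < M) {t : ℝ}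
    (ht : t ∈ Ioo 0 T) : HasDerivAt (shotEnergy M L u v)
      (-(2 * (Real.cos (2 * t) / Real.sin (2 * t))) * v t ^ 2) t := by
  refine (h.hasDerivAt_energy hM ⟨ht.1.le, ht.2⟩).congr_deriv ?_
  rw [h.ode t ht]; ring

theorem IsShot.energy_le_before (h : IsShot (toroForce M) L T d u v a) (hM : 1 < M)
    (hT' : T < Real.pi / 2) (hL : 0 < L) (hd : d ∈ Ioo 0 1) {t : ℝ} (ht : t ∈ Ico 0 T)
    (ht4 : t ≤ Real.pi / 4) : shotEnergy M L u v t ≤ L / 3 := by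
  have hsub : Icc 0 t ⊆ Ico 0 T := fun s hs => ⟨hs.1, hs.2.trans_lt ht.2⟩
  have hanti : AntitoneOn (shotEnergy M L u v) (Icc 0 t) := by
    refine antitoneOn_of_deriv_nonpos (convex_Icc _ _)
      (fun s hs => (h.hasDerivAt_energy hM (hsub hs)).continuousAt.continuousWithinAt)
      (fun s hs => (h.hasDerivAt_energy hM (hsub (interior_subset hs))).differentiableAt
        |>.differentiableWithinAt) fun s hs => ?_
    rw [interior_Icc] at hs
    have hs' : s ∈ Ioo 0 T := ⟨hs.1, hs.2.trans ht.2⟩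
    rw [(h.hasDerivAt_energy' hM hs').deriv]
    have h1 := sin_two_mul_pos hT' hs'
    have h2 : 0 ≤ Real.cos (2 * s) := Real.cos_nonneg_of_mem_Icc
      ⟨by linarith [Real.pi_pos, hs.1], by linarith [hs.2]⟩
    have h3 := div_nonneg h2 h1.le
    nlinarith [mul_nonneg h3 (sq_nonneg (v s))]
  refine (hanti ⟨le_rfl, ht.1⟩ ⟨ht.1, le_rfl⟩ ht.1).trans ?_
  rw [shotEnergy, h.v_zero, h.u_zero, toroPotential_of_mem hM ⟨hd.1.le, by linarith [hd.2]⟩]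
  have h6 : d ^ 6 ≤ d ^ 2 := pow_le_pow_of_le_one hd.1.le hd.2.le (by norm_num)
  nlinarith [sq_nonneg d]

/-- A bound on the height of the solutions which depends neither on `L` nor on `d`. After `π/4`
it comes from the monotone quantity `sin² (2t) (v² / 2 + L W(u))`. -/
theorem IsShot.potential_le (h : IsShot (toroForce M) L T d u v a) (hM : 1 < M)
    (hT : Real.pi / 4 < T) (hT' : T < Real.pi / 2) (hL : 0 < L) (hd : d ∈ Ioo 0 1) {t : ℝ}
    (ht : t ∈ Ico 0 T) : Real.sin (2 * T) ^ 2 * toroPotential M (u t) ≤ 1 / 3 := by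
  have hpi := Real.pi_pos
  have hW := toroPotential_nonneg hM (u t)
  rcases le_total t (Real.pi / 4) with h4 | h4
  · have h1 := h.energy_le_before hM hT' hL hd ht h4
    have h2 : L * toroPotential M (u t) ≤ L / 3 := by
      unfold shotEnergy at h1; nlinarith [sq_nonneg (v t)]
    have h3 : toroPotential M (u t) ≤ 1 / 3 := by
      have : L * toroPotential M (u t) ≤ L * (1 / 3) := by linarith
      exact le_of_mul_le_mul_left this hL
    nlinarith [Real.sin_sq_le_one (2 * T)]
  · have hsub : Icc (Real.pi / 4) t ⊆ Ioo 0 T := fun s hs =>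
      ⟨by linarith [hs.1], hs.2.trans_lt ht.2⟩
    have hd' : ∀ s ∈ Icc (Real.pi / 4) t, HasDerivAt
        (fun s => Real.sin (2 * s) ^ 2 * shotEnergy M L u v s)
        (4 * L * (Real.sin (2 * s) * Real.cos (2 * s)) * toroPotential M (u s)) s := by
      intro s hs
      have h3 : HasDerivAt (fun t : ℝ => 2 * t) 2 s := by
        simpa using (hasDerivAt_id s).const_mul 2
      refine ((h3.sin.pow 2).mul (h.hasDerivAt_energy' hM (hsub hs))).congr_deriv ?_
      have := (sin_two_mul_pos hT' (hsub hs)).ne'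
      simp only [shotEnergy, Pi.pow_apply]
      field_simp
      ring
    have hanti : AntitoneOn (fun s => Real.sin (2 * s) ^ 2 * shotEnergy M L u v s)
        (Icc (Real.pi / 4) t) := by
      refine antitoneOn_of_deriv_nonpos (convex_Icc _ _)
        (fun s hs => (hd' s hs).continuousAt.continuousWithinAt)
        (fun s hs => (hd' s (interior_subset hs)).differentiableAt.differentiableWithinAt)
        fun s hs => ?_
      have hs' := interior_subset hs
      rw [(hd' s hs').deriv]
      have h1 := sin_two_mul_pos hT' (hsub hs')
      have h2 : Real.cos (2 * s) ≤ 0 := Real.cos_nonpos_of_pi_div_two_le_of_le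
        (by linarith [hs'.1]) (by linarith [(hsub hs').2])
      have h3 : Real.sin (2 * s) * Real.cos (2 * s) ≤ 0 := mul_nonpos_of_nonneg_of_nonpos h1.le h2
      have h4 := toroPotential_nonneg hM (u s)
      exact mul_nonpos_of_nonpos_of_nonneg (mul_nonpos_of_nonneg_of_nonpos (by linarith) h3) h4
    have h1 := hanti ⟨le_rfl, h4⟩ ⟨h4, le_rfl⟩ h4
    have h2 := h.energy_le_before hM hT' hL hd ⟨by linarith, hT⟩ le_rfl
    simp only at h1
    rw [show 2 * (Real.pi / 4) = Real.pi / 2 by ring, Real.sin_pi_div_two] at h1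
    have h5 : Real.sin (2 * T) ≤ Real.sin (2 * t) := by
      rw [← Real.sin_pi_sub (2 * T), ← Real.sin_pi_sub (2 * t)]
      exact Real.sin_le_sin_of_le_of_le_pi_div_two (by linarith) (by linarith) (by linarith [ht.2])
    have h6 : 0 < Real.sin (2 * T) :=
      Real.sin_pos_of_pos_of_lt_pi (by linarith) (by linarith)
    have h7 : Real.sin (2 * T) ^ 2 ≤ Real.sin (2 * t) ^ 2 := by gcongr
    have h8 : Real.sin (2 * t) ^ 2 * (L * toroPotential M (u t)) ≤ L / 3 := by
      have : Real.sin (2 * t) ^ 2 * shotEnergy M L u v t ≤ L / 3 := by linarith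
      unfold shotEnergy at this
      nlinarith [mul_nonneg (sq_nonneg (Real.sin (2 * t))) (sq_nonneg (v t))]
    have h9 : L * (Real.sin (2 * T) ^ 2 * toroPotential M (u t)) ≤ L * (1 / 3) := by
      nlinarith [mul_le_mul_of_nonneg_right h7 (mul_nonneg hL.le hW)]
    exact le_of_mul_le_mul_left h9 hL

theorem IsShot.u_lt (h : IsShot (toroForce M) L T d u v a) (hM : 1 < M)
    (hT : Real.pi / 4 < T) (hT' : T < Real.pi / 2) (hL : 0 < L) (hd : d ∈ Ioo 0 1)
    (hMT : 1 / 3 < Real.sin (2 * T) ^ 2 * (M ^ 6 / 6 - M ^ 2 / 2 + 1 / 3)) {t : ℝ}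
    (ht : t ∈ Ico 0 T) : u t < M := by
  by_contra hcon
  obtain ⟨c, hc, hc0, -⟩ := exists_first_zero (g := fun s => u s - M) ht.1
    ((h.continuousOn_u.sub continuousOn_const).mono fun s hs => ⟨hs.1, hs.2.trans_lt ht.2⟩)
    (by rw [h.u_zero]; linarith [hd.2]) (by linarith)
  have h1 := h.potential_le hM hT hT' hL hd ⟨hc.1.le, hc.2.trans_lt ht.2⟩
  rw [show u c = M by linarith, toroPotential_of_mem hM ⟨by linarith, le_rfl⟩] at h1
  linarith

end Shot

/-! ### The angle about the equilibrium and the spikes -/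

section Angle

variable {L T d M ω b : ℝ} {u v a φ : ℝ → ℝ}

/-- The angular velocity of the point `ω (u - 1) - i v` about the origin. -/
noncomputable def angularSpeed (ω : ℝ) (u v a : ℝ → ℝ) (t : ℝ) : ℝ :=
  ω * (v t ^ 2 - a t * (u t - 1)) / (ω ^ 2 * (u t - 1) ^ 2 + v t ^ 2)

/-- `φ` is the continuous argument on `[0, b]` of `ω (u - 1) - i v`, starting from `-π`. -/
structure IsAngle (ω b : ℝ) (u v a φ : ℝ → ℝ) : Prop where
  zero : φ 0 = -Real.pi
  hasDerivAt : ∀ t ∈ Icc 0 b, HasDerivAt φ (angularSpeed ω u v a t) t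

/-- If `φ` has positive derivative wherever it takes the value `c`, it can only cross `c` upwards. -/
theorem lt_of_upcrossing {φ φ' : ℝ → ℝ} {p q c : ℝ} (hpq : p < q)
    (hφ : ∀ t ∈ Icc p q, HasDerivAt φ (φ' t) t) (hc : ∀ t ∈ Icc p q, φ t = c → 0 < φ' t)
    (hp : c ≤ φ p) : c < φ q := by
  have hle : ∀ t ∈ Icc p q, c ≤ φ t := fun t ht =>
    image_le_of_deriv_right_lt_deriv_boundary' (f := fun _ => c) (f' := fun _ => 0)
      continuousOn_const (fun x _ => hasDerivWithinAt_const _ _ _) hp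
      (fun x hx => (hφ x hx).continuousAt.continuousWithinAt)
      (fun x hx => (hφ x ⟨hx.1, hx.2.le⟩).hasDerivWithinAt)
      (fun x hx h => hc x ⟨hx.1, hx.2.le⟩ h.symm) ht
  refine lt_of_le_of_ne (hle q ⟨hpq.le, le_rfl⟩) fun h => ?_
  have hq : q ∈ Icc p q := ⟨hpq.le, le_rfl⟩
  have h1 := (hφ q hq).tendsto_slope.mono_left (nhdsWithin_mono q
      (show Iio q ⊆ {q}ᶜ from fun t (ht : t < q) => ht.ne))
  have h2 : φ' q ≤ 0 := by
    refine le_of_tendsto h1 ?_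
    filter_upwards [Ioo_mem_nhdsLT hpq] with t ht
    rw [slope_def_field, ← h]
    exact div_nonpos_of_nonneg_of_nonpos (by linarith [hle t ⟨ht.1.le, ht.2.le⟩])
      (by linarith [ht.2])
  exact absurd (hc q hq h.symm) (not_lt.2 h2)

theorem IsAngle.continuousOn (hφ : IsAngle ω b u v a φ) : ContinuousOn φ (Icc 0 b) :=
  fun t ht => (hφ.hasDerivAt t ht).continuousAt.continuousWithinAt

/-- Polar coordinates around the equilibrium `(u, v) = (1, 0)`. -/
theorem IsAngle.polar (hφ : IsAngle ω b u v a φ) (h : IsShot (toroForce M) L T d u v a)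
    (hT' : T < Real.pi / 2) (hM : 1 < M) (hd : d ∈ Ioo 0 1) (hω : 0 < ω) (hb : b < T) {t : ℝ}
    (ht : t ∈ Icc 0 b) :
    ∃ ρ, 0 < ρ ∧ ω * (u t - 1) = ρ * Real.cos (φ t) ∧ v t = -(ρ * Real.sin (φ t)) := by
  have hsub : Icc 0 b ⊆ Ico 0 T := fun s hs => ⟨hs.1, hs.2.trans_lt hb⟩
  have hN := fun s (hs : s ∈ Icc 0 b) => h.denominator_pos hT' hM hd.2.ne hω (hsub hs)
  have hdu := fun s (hs : s ∈ Icc 0 b) => (h.hasDerivAt_u s (hsub hs))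
  have hdv := fun s (hs : s ∈ Icc 0 b) => (h.hasDerivAt_v s (hsub hs))
  set e : ℝ → ℝ := fun t => ω * (u t - 1) * Real.sin (φ t) + v t * Real.cos (φ t) with he
  set g : ℝ → ℝ := fun t => ω * (u t - 1) * Real.cos (φ t) - v t * Real.sin (φ t) with hg
  have hde : ∀ s ∈ Icc 0 b, HasDerivAt
      (fun s => e s ^ 2 / (ω ^ 2 * (u s - 1) ^ 2 + v s ^ 2)) 0 s := by
    intro s hs
    have h1 := ((((hdu s hs).sub_const 1).const_mul ω).mul (hφ.hasDerivAt s hs).sin).add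
      ((hdv s hs).mul (hφ.hasDerivAt s hs).cos)
    have h2 := ((((hdu s hs).sub_const 1).pow 2).const_mul (ω ^ 2)).add ((hdv s hs).pow 2)
    refine ((h1.pow 2).div h2 (hN s hs).ne').congr_deriv ?_
    have := (hN s hs).ne'
    simp only [angularSpeed, Pi.add_apply, Pi.mul_apply, Pi.pow_apply]
    field_simp
    ring
  have h0b : (0 : ℝ) ∈ Icc 0 b := ⟨le_rfl, ht.1.trans ht.2⟩
  have hanti := antitoneOn_of_deriv_nonpos (convex_Icc 0 b)
      (fun s hs => (hde s hs).continuousAt.continuousWithinAt)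
      (fun s hs => (hde s (interior_subset hs)).differentiableAt.differentiableWithinAt)
      (fun s hs => (hde s (interior_subset hs)).deriv.le)
  have he0 : ∀ s ∈ Icc 0 b, e s = 0 := by
    intro s hs
    have h1 := hanti h0b hs hs.1
    have h2 : e 0 = 0 := by simp [he, hφ.zero, h.v_zero]
    simp only [h2] at h1
    have h3 : e s ^ 2 / (ω ^ 2 * (u s - 1) ^ 2 + v s ^ 2) ≤ 0 := by simpa using h1
    have h4 : e s ^ 2 ≤ 0 := by
      rw [div_le_iff₀ (hN s hs)] at h3; linarith
    exact pow_eq_zero_iff two_ne_zero |>.1 (le_antisymm h4 (sq_nonneg _))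
  have hsum : ∀ s, g s ^ 2 + e s ^ 2 = ω ^ 2 * (u s - 1) ^ 2 + v s ^ 2 := by
    intro s
    simp only [he, hg]
    nlinarith [Real.sin_sq_add_cos_sq (φ s)]
  have hgc : ContinuousOn g (Icc 0 b) := by
    have h1 := hφ.continuousOn
    have h2 := h.continuousOn_u.mono hsub
    have h3 := h.continuousOn_v.mono hsub
    have h4 := Real.continuous_cos.comp_continuousOn h1
    have h5 := Real.continuous_sin.comp_continuousOn h1
    exact (((continuousOn_const.mul (h2.sub continuousOn_const))).mul h4).sub (h3.mul h5)
  have hg0 : 0 < g 0 := by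
    simp only [hg, hφ.zero, h.v_zero, h.u_zero]
    simp
    nlinarith [hd.2]
  have hgpos : 0 < g t := by
    by_contra hcon
    obtain ⟨c, hc, hc0, -⟩ := exists_first_zero (g := fun s => -g s) ht.1
      (hgc.neg.mono (Icc_subset_Icc_right ht.2)) (by simpa using hg0) (by linarith)
    have hc' : c ∈ Icc 0 b := ⟨hc.1.le, hc.2.trans ht.2⟩
    have h1 := hsum c
    have h2 := hN c hc'
    rw [← h1, he0 c hc', show g c = 0 by linarith] at h2
    simp at h2
  refine ⟨g t, hgpos, ?_, ?_⟩
  · have h1 := he0 t ht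
    simp only [he] at h1
    simp only [hg]
    linear_combination (ω * (u t - 1)) * -(Real.sin_sq_add_cos_sq (φ t)) + Real.sin (φ t) * h1
  · have h1 := he0 t ht
    simp only [he] at h1
    simp only [hg]
    linear_combination (v t) * -(Real.sin_sq_add_cos_sq (φ t)) + Real.cos (φ t) * h1

theorem IsShot.u_pos_of_v_eq_zero (h : IsShot (toroForce M) L T d u v a)
    (hT' : T < Real.pi / 2) (hM : 1 < M) (hd : 0 < d) {t : ℝ} (ht : t ∈ Ico 0 T)
    (hv : v t = 0) : 0 < u t := by
  by_contra hcon
  exact (h.v_neg_of_nonpos hT' hM hd ht (not_lt.1 hcon) t ⟨le_rfl, ht.2⟩).ne hv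

theorem IsShot.a_mul_neg (h : IsShot (toroForce M) L T d u v a) (hL : 0 < L)
    (hT' : T < Real.pi / 2) (hM : 1 < M) (hd : d ∈ Ioo 0 1) {t : ℝ} (ht : t ∈ Ico 0 T)
    (hv : v t = 0) : a t * (u t - 1) < 0 := by
  have hu := h.u_pos_of_v_eq_zero hT' hM hd.1 ht hv
  have hu1 : u t ≠ 1 := fun hu1 => hd.2.ne <| h.eq_of_equilibrium hT'
    (lipschitzWith_toroForce hM) (toroForce_one hM) ht hu1 hv
  have hf := mul_pos hL (toroForce_mul_sub_one_pos hM hu hu1)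
  rcases eq_or_lt_of_le ht.1 with h0 | h0
  · subst h0
    rw [h.a_zero]
    rw [h.u_zero] at hf ⊢
    linarith
  · rw [h.ode t ⟨h0, ht.2⟩, hv]
    linarith

/-- The angle crosses the multiples of `π`, i.e. the critical points of `u`, only upwards. -/
theorem IsAngle.lt_of_le (hφ : IsAngle ω b u v a φ) (h : IsShot (toroForce M) L T d u v a)
    (hL : 0 < L) (hT' : T < Real.pi / 2) (hM : 1 < M) (hd : d ∈ Ioo 0 1) (hω : 0 < ω) (hb : b < T)
    {p q : ℝ} (hp : 0 ≤ p) (hpq : p < q) (hq : q ≤ b) {n : ℤ} (hn : n * Real.pi ≤ φ p) :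
    n * Real.pi < φ q := by
  have hsub : Icc p q ⊆ Icc 0 b := Icc_subset_Icc hp hq
  refine lt_of_upcrossing hpq (fun t ht => hφ.hasDerivAt t (hsub ht)) (fun t ht htn => ?_) hn
  obtain ⟨ρ, hρ, h1, h2⟩ := hφ.polar h hT' hM hd hω hb (hsub ht)
  have hv : v t = 0 := by rw [h2, htn, Real.sin_int_mul_pi]; simp
  have htT : t ∈ Ico 0 T := ⟨(hsub ht).1, (hsub ht).2.trans_lt hb⟩
  have h3 := h.a_mul_neg hL hT' hM hd htT hv
  have h4 := h.denominator_pos hT' hM hd.2.ne hω htT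
  refine div_pos (mul_pos hω ?_) h4
  rw [hv]; linarith

theorem IsAngle.neg_pi_lt (hφ : IsAngle ω b u v a φ) (h : IsShot (toroForce M) L T d u v a)
    (hL : 0 < L) (hT' : T < Real.pi / 2) (hM : 1 < M) (hd : d ∈ Ioo 0 1) (hω : 0 < ω) (hb : b < T)
    {t : ℝ} (ht : t ∈ Ioc 0 b) : -Real.pi < φ t := by
  have := hφ.lt_of_le h hL hT' hM hd hω hb le_rfl ht.1 ht.2 (n := -1) (by rw [hφ.zero]; simp)
  simpa using this

theorem sin_pos_of_mem_strip {x : ℝ} {i : ℕ} (h1 : 2 * Real.pi * i < x)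
    (h2 : x < 2 * Real.pi * i + Real.pi) : 0 < Real.sin x := by
  rw [← Real.sin_sub_nat_mul_two_pi x i]
  exact Real.sin_pos_of_pos_of_lt_pi (by linarith) (by linarith)

theorem IsShot.deriv_u (h : IsShot (toroForce M) L T d u v a) {t : ℝ} (ht : t ∈ Ico 0 T) :
    deriv u t = v t := (h.hasDerivAt_u t ht).deriv

theorem IsShot.deriv_deriv_u (h : IsShot (toroForce M) L T d u v a) {t : ℝ} (ht : t ∈ Ioo 0 T) :
    deriv (deriv u) t = a t := by
  have h1 : deriv u =ᶠ[𝓝 t] v := by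
    filter_upwards [Ioo_mem_nhds ht.1 ht.2] with s hs
    exact h.deriv_u ⟨hs.1.le, hs.2⟩
  rw [h1.deriv_eq]
  exact (h.hasDerivAt_v t ⟨ht.1.le, ht.2⟩).deriv

theorem IsAngle.isLocalMax_iff (hφ : IsAngle ω b u v a φ) (h : IsShot (toroForce M) L T d u v a)
    (hL : 0 < L) (hT' : T < Real.pi / 2) (hM : 1 < M) (hd : d ∈ Ioo 0 1) (hω : 0 < ω) (hb : b < T)
    {t : ℝ} (ht : t ∈ Ioo 0 b) : IsLocalMax u t ↔ ∃ m : ℕ, φ t = 2 * Real.pi * m := by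
  have htT : t ∈ Ioo 0 T := ⟨ht.1, ht.2.trans hb⟩
  have htT' : t ∈ Ico 0 T := ⟨ht.1.le, ht.2.trans hb⟩
  obtain ⟨ρ, hρ, h1, h2⟩ := hφ.polar h hT' hM hd hω hb ⟨ht.1.le, ht.2.le⟩
  have hcont := (h.hasDerivAt_u t htT').continuousAt
  constructor
  · intro hmax
    have hv : v t = 0 := hmax.hasDerivAt_eq_zero (h.hasDerivAt_u t htT')
    have ha := h.a_mul_neg hL hT' hM hd htT' hv
    have hs : Real.sin (φ t) = 0 := by
      rw [hv] at h2
      have : ρ * Real.sin (φ t) = 0 := by linarith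
      exact (mul_eq_zero.1 this).resolve_left hρ.ne'
    have hu : 1 < u t := by
      by_contra hcon
      have ha' : 0 < a t := by nlinarith
      have hmin : IsLocalMin u t := isLocalMin_of_deriv_deriv_pos
        (by rw [h.deriv_deriv_u htT]; exact ha') (by rw [h.deriv_u htT', hv]) hcont
      have hconst : u =ᶠ[𝓝 t] fun _ => u t := by
        filter_upwards [hmax, hmin] with s h1 h2
        exact le_antisymm h1 h2
      have := hconst.deriv.deriv_eq
      rw [h.deriv_deriv_u htT] at this
      simp at this
      linarith
    have hc : 0 < Real.cos (φ t) := by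
      by_contra hcon
      nlinarith
    obtain ⟨n, hn⟩ := Real.sin_eq_zero_iff.1 hs
    have hn1 : Real.cos (n * Real.pi) = (-1) ^ n := Real.cos_int_mul_pi n
    rw [hn] at hn1
    obtain ⟨m, rfl | rfl⟩ := n.even_or_odd'
    · have h3 := hφ.neg_pi_lt h hL hT' hM hd hω hb ⟨ht.1, ht.2.le⟩
      have hm : 0 ≤ m := by
        by_contra hm
        have hm' : (m : ℝ) ≤ -1 := by exact_mod_cast (by omega : m ≤ -1)
        push_cast at hn
        nlinarith [Real.pi_pos]
      obtain ⟨k, rfl⟩ := Int.eq_ofNat_of_zero_le hm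
      exact ⟨k, by rw [← hn]; push_cast; ring⟩
    · rw [Odd.neg_one_zpow ⟨m, rfl⟩] at hn1
      linarith
  · rintro ⟨m, hm⟩
    have e : φ t = m * (2 * Real.pi) := by rw [hm]; ring
    have hs : Real.sin (φ t) = 0 := by
      rw [e, show (m : ℝ) * (2 * Real.pi) = ((2 * m : ℕ) : ℝ) * Real.pi by push_cast; ring]
      exact Real.sin_nat_mul_pi _
    have hc : Real.cos (φ t) = 1 := by rw [e]; exact Real.cos_nat_mul_two_pi m
    have hv : v t = 0 := by rw [h2, hs]; simp
    rw [hc] at h1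
    have ha := h.a_mul_neg hL hT' hM hd htT' hv
    have hu : 0 < u t - 1 := by
      by_contra hcon
      nlinarith
    have ha' : a t < 0 := by
      by_contra hcon
      nlinarith
    exact isLocalMax_of_deriv_deriv_neg (by rw [h.deriv_deriv_u htT]; exact ha')
      (by rw [h.deriv_u htT', hv]) hcont

/-- The number of spikes is read off from the final angle. -/
theorem IsAngle.encard_spikes (hφ : IsAngle ω b u v a φ) (h : IsShot (toroForce M) L T d u v a)
    (hL : 0 < L) (hT' : T < Real.pi / 2) (hM : 1 < M) (hd : d ∈ Ioo 0 1) (hω : 0 < ω) (hb0 : 0 < b)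
    (hb : b < T) {i : ℕ} (h1 : 2 * Real.pi * i < φ b) (h2 : φ b < 2 * Real.pi * i + Real.pi) :
    (spikes b u).encard = ((i + 1 : ℕ) : ℕ∞) := by
  have hpi := Real.pi_pos
  have hcross : ∀ p q : ℝ, ∀ m : ℕ, 0 ≤ p → p < q → q ≤ b → 2 * Real.pi * m ≤ φ p →
      2 * Real.pi * m < φ q := by
    intro p q m hp hpq hq hm
    have := hφ.lt_of_le h hL hT' hM hd hω hb hp hpq hq (n := 2 * m)
      (by push_cast; linarith)
    push_cast at this
    linarith
  have hex : ∀ m : ℕ, ∃ t, m ≤ i → t ∈ Ioo 0 b ∧ φ t = 2 * Real.pi * m := by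
    intro m
    by_cases hm : m ≤ i
    · have hm' : (m : ℝ) ≤ i := by exact_mod_cast hm
      obtain ⟨t, ht, ht'⟩ := intermediate_value_Ioo hb0.le hφ.continuousOn
        (show 2 * Real.pi * m ∈ Ioo (φ 0) (φ b) from
          ⟨by rw [hφ.zero]; nlinarith [mul_nonneg hpi.le (Nat.cast_nonneg (α := ℝ) m)],
            by nlinarith⟩)
      exact ⟨t, fun _ => ⟨ht, ht'⟩⟩
    · exact ⟨0, fun h => absurd h hm⟩
  choose τ hτ using hex
  have himage : spikes b u = τ '' (Finset.range (i + 1) : Set ℕ) := by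
    ext t
    constructor
    · rintro ⟨ht, hmax⟩
      obtain ⟨m, hm⟩ := (hφ.isLocalMax_iff h hL hT' hM hd hω hb ht).1 hmax
      have hmi : m ≤ i := by
        by_contra hcon
        have hcon' : (i : ℝ) + 1 ≤ m := by exact_mod_cast (by omega : i + 1 ≤ m)
        have := hcross t b m ht.1.le ht.2 le_rfl hm.ge
        nlinarith
      refine ⟨m, by simpa using Nat.lt_succ_of_le hmi, ?_⟩
      obtain ⟨h3, h4⟩ := hτ m hmi
      by_contra hne
      rcases lt_or_gt_of_ne hne with hlt | hlt
      · exact (hcross _ _ m h3.1.le hlt ht.2.le h4.ge).ne' hm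
      · exact (hcross _ _ m ht.1.le hlt h3.2.le hm.ge).ne' h4
    · rintro ⟨m, hm, rfl⟩
      have hmi : m ≤ i := by simpa [Nat.lt_succ_iff] using hm
      exact ⟨(hτ m hmi).1, (hφ.isLocalMax_iff h hL hT' hM hd hω hb (hτ m hmi).1).2
        ⟨m, (hτ m hmi).2⟩⟩
  have hinj : InjOn τ (Finset.range (i + 1) : Set ℕ) := by
    intro m hm n hn hmn
    have hmi : m ≤ i := by simpa [Nat.lt_succ_iff] using hm
    have hni : n ≤ i := by simpa [Nat.lt_succ_iff] using hn
    have h3 := (hτ m hmi).2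
    rw [hmn, (hτ n hni).2] at h3
    have h4 : (n : ℝ) = m := mul_left_cancel₀ (by positivity) h3
    exact_mod_cast h4.symm
  rw [himage, hinj.encard_image, Set.encard_coe_eq_coe_finsetCard, Finset.card_range]

end Angle

/-! ### Boundary value solutions and large frequencies -/

section Solutions

variable {L T d M ω b : ℝ} {u v a φ : ℝ → ℝ}

theorem IsShot.contDiffOn (h : IsShot (toroForce M) L T d u v a) (hb0 : 0 < b) (hb : b < T)
    (ha : Continuous a) : ContDiffOn ℝ 2 u (Icc 0 b) := by
  have hsub : Icc 0 b ⊆ Ico 0 T := fun s hs => ⟨hs.1, hs.2.trans_lt hb⟩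
  have hud := uniqueDiffOn_Icc hb0
  have h1 : ∀ t ∈ Icc 0 b, derivWithin u (Icc 0 b) t = v t := fun t ht =>
    (h.hasDerivAt_u t (hsub ht)).hasDerivWithinAt.derivWithin (hud t ht)
  have h2 : ∀ t ∈ Icc 0 b, derivWithin v (Icc 0 b) t = a t := fun t ht =>
    (h.hasDerivAt_v t (hsub ht)).hasDerivWithinAt.derivWithin (hud t ht)
  have hv : ContDiffOn ℝ 1 v (Icc 0 b) := by
    rw [show (1 : WithTop ℕ∞) = 0 + 1 by norm_num, contDiffOn_succ_iff_derivWithin hud]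
    refine ⟨fun t ht => (h.hasDerivAt_v t (hsub ht)).differentiableAt.differentiableWithinAt,
      by simp, ?_⟩
    exact contDiffOn_zero.2 (ha.continuousOn.congr h2)
  rw [show (2 : WithTop ℕ∞) = 1 + 1 by norm_num, contDiffOn_succ_iff_derivWithin hud]
  exact ⟨fun t ht => (h.hasDerivAt_u t (hsub ht)).differentiableAt.differentiableWithinAt,
    by simp, hv.congr h1⟩

theorem IsShot.pos_of_boundary (h : IsShot (toroForce M) L T d u v a)
    (hT' : T < Real.pi / 2) (hM : 1 < M) (hd : 0 < d) (hb : b < T) (hub : u b = 0) :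
    ∀ t ∈ Ioo 0 b, 0 < u t := by
  intro t ht
  by_contra hcon
  have hsub : Icc t b ⊆ Ico 0 T := fun s hs => ⟨ht.1.le.trans hs.1, hs.2.trans_lt hb⟩
  have hv := h.v_neg_of_nonpos hT' hM hd (hsub ⟨le_rfl, ht.2.le⟩) (not_lt.1 hcon)
  have hanti : StrictAntiOn u (Icc t b) := by
    refine strictAntiOn_of_deriv_neg (convex_Icc _ _) (h.continuousOn_u.mono hsub) fun s hs => ?_
    have hs' := interior_subset hs
    rw [h.deriv_u (hsub hs')]
    exact hv s ⟨hs'.1, hs'.2.trans_lt hb⟩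
  have := hanti ⟨le_rfl, ht.2.le⟩ ⟨ht.2.le, le_rfl⟩ ht.2
  linarith [not_lt.1 hcon]

theorem IsShot.isToroSolution (h : IsShot (toroForce M) L T d u v a)
    (hT : Real.pi / 4 < T) (hT' : T < Real.pi / 2) (hM : 1 < M) (hL : 0 < L) (hd : d ∈ Ioo 0 1)
    (hMT : 1 / 3 < Real.sin (2 * T) ^ 2 * (M ^ 6 / 6 - M ^ 2 / 2 + 1 / 3))
    (hb0 : 0 < b) (hb : b < T) (ha : Continuous a) (hub : u b = 0) :
    IsToroSolution (-L) b u where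
  contDiffOn := h.contDiffOn hb0 hb ha
  pos := h.pos_of_boundary hT' hM hd.1 hb hub
  boundary := hub
  deriv_zero := by
    have := h.hasDerivAt_u 0 ⟨le_rfl, hb0.trans hb⟩
    rw [h.v_zero] at this
    exact this.hasDerivWithinAt
  ode := fun t ht => by
    have ht' : t ∈ Ioo 0 T := ⟨ht.1, ht.2.trans hb⟩
    rw [h.deriv_deriv_u ht', h.deriv_u ⟨ht'.1.le, ht'.2⟩, h.ode t ht', toroForce_of_mem
      ⟨(h.pos_of_boundary hT' hM hd.1 hb hub t ht).le,
        (h.u_lt hM hT hT' hL hd hMT ⟨ht'.1.le, ht'.2⟩).le⟩]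
    ring

end Solutions

section LargeFrequency

variable {T d M ω b C C₀ c₀ θs θp : ℝ} {u v a φ : ℝ → ℝ} {i k : ℕ}

/-- Away from the equilibrium `u = 0` the solution turns fast. -/
theorem IsShot.le_angularSpeed (h : IsShot (toroForce M) (ω ^ 2) T d u v a)
    (hT' : T < Real.pi / 2) (hM : 1 < M) (hd : d ∈ Ioo 0 1) (hω : 0 < ω) {m t : ℝ} (hm : 0 < m)
    (hm1 : m ≤ 1) (ht : t ∈ Ioo 0 T)
    (hC₀ : |2 * (Real.cos (2 * t) / Real.sin (2 * t))| ≤ C₀) (hmu : m ≤ u t) (huM : u t ≤ M) :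
    ω * m - C₀ / 2 ≤ angularSpeed ω u v a t := by
  have hN := h.denominator_pos hT' hM hd.2.ne hω ⟨ht.1.le, ht.2⟩
  rw [angularSpeed, le_div_iff₀ hN, h.ode t ht, toroForce_of_mem ⟨hm.le.trans hmu, huM⟩]
  set q := 2 * (Real.cos (2 * t) / Real.sin (2 * t))
  set x := u t
  set y := v t
  have hu0 : 0 < x := hm.trans_le hmu
  have h1 : m * (x - 1) ^ 2 ≤ (x ^ 5 - x) * (x - 1) := by
    have e : (x ^ 5 - x) * (x - 1) = (x * (x + 1) * (x ^ 2 + 1)) * (x - 1) ^ 2 := by ring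
    rw [e]
    refine mul_le_mul_of_nonneg_right ?_ (sq_nonneg _)
    nlinarith [pow_pos hu0 2, pow_pos hu0 3, pow_pos hu0 4]
  have h2 : -(C₀ / 2 * (ω ^ 2 * (x - 1) ^ 2 + y ^ 2)) ≤ ω * (q * y * (x - 1)) := by
    have e1 : |q * (y * (ω * (x - 1)))| ≤ C₀ * ((ω ^ 2 * (x - 1) ^ 2 + y ^ 2) / 2) := by
      rw [abs_mul]
      refine mul_le_mul hC₀ ?_ (abs_nonneg _) ((abs_nonneg _).trans hC₀)
      rw [abs_le]
      constructor <;> nlinarith [sq_nonneg (y + ω * (x - 1)), sq_nonneg (y - ω * (x - 1))]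
    have := (abs_le.1 e1).1
    nlinarith
  have h3 : ω * m * y ^ 2 ≤ ω * y ^ 2 := by
    nlinarith [mul_nonneg hω.le (sq_nonneg y)]
  have h4 := mul_le_mul_of_nonneg_left h1 (pow_pos hω 3).le
  nlinarith

theorem IsAngle.rotation (hφ : IsAngle ω b u v a φ) (h : IsShot (toroForce M) (ω ^ 2) T d u v a)
    (hT : Real.pi / 4 < T) (hT' : T < Real.pi / 2) (hM : 1 < M) (hd : d ∈ Ioo 0 1) (hω : 0 < ω)
    (hMT : 1 / 3 < Real.sin (2 * T) ^ 2 * (M ^ 6 / 6 - M ^ 2 / 2 + 1 / 3)) (hb : b < T)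
    (hC₀ : ∀ t ∈ Icc (Real.pi / 4) b, |2 * (Real.cos (2 * t) / Real.sin (2 * t))| ≤ C₀)
    {p q m : ℝ} (hp : Real.pi / 4 ≤ p) (hpq : p ≤ q) (hq : q ≤ b) (hm : 0 < m) (hm1 : m ≤ 1)
    (hmu : ∀ t ∈ Icc p q, m ≤ u t) : (ω * m - C₀ / 2) * (q - p) ≤ φ q - φ p := by
  have hpi := Real.pi_pos
  have hsub : Icc p q ⊆ Icc 0 b := Icc_subset_Icc (by linarith) hq
  refine (convex_Icc p q).mul_sub_le_image_sub_of_le_deriv (hφ.continuousOn.mono hsub)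
    (fun t ht => (hφ.hasDerivAt t (hsub (interior_subset ht))).differentiableAt
      |>.differentiableWithinAt) (fun t ht => ?_) p ⟨le_rfl, hpq⟩ q ⟨hpq, le_rfl⟩ hpq
  have ht' := interior_subset ht
  have htT : t ∈ Ioo 0 T := ⟨by linarith [ht'.1], by linarith [ht'.2]⟩
  rw [(hφ.hasDerivAt t (hsub ht')).deriv]
  exact h.le_angularSpeed hT' hM hd hω hm hm1 htT
    (hC₀ t ⟨hp.trans ht'.1, ht'.2.trans hq⟩) (hmu t ht')
    (h.u_lt hM hT hT' (by positivity) hd hMT ⟨htT.1.le, htT.2⟩).le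

theorem IsShot.monotoneOn_energy (h : IsShot (toroForce M) (ω ^ 2) T d u v a)
    (hT' : T < Real.pi / 2) (hM : 1 < M) (hb : b < T) :
    MonotoneOn (shotEnergy M (ω ^ 2) u v) (Icc (Real.pi / 4) b) := by
  have hpi := Real.pi_pos
  have hsub : Icc (Real.pi / 4) b ⊆ Ioo 0 T := fun s hs =>
    ⟨by linarith [hs.1], hs.2.trans_lt hb⟩
  refine monotoneOn_of_deriv_nonneg (convex_Icc _ _)
    (fun s hs => (h.hasDerivAt_energy' hM (hsub hs)).continuousAt.continuousWithinAt)
    (fun s hs => (h.hasDerivAt_energy' hM (hsub (interior_subset hs))).differentiableAt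
      |>.differentiableWithinAt) fun s hs => ?_
  have hs' := interior_subset hs
  rw [(h.hasDerivAt_energy' hM (hsub hs')).deriv]
  have h2 : Real.cos (2 * s) ≤ 0 := Real.cos_nonpos_of_pi_div_two_le_of_le
    (by linarith [hs'.1]) (by linarith [(hsub hs').2])
  have h3 := div_nonpos_of_nonpos_of_nonneg h2 (sin_two_mul_pos hT' (hsub hs')).le
  nlinarith [sq_nonneg (v s)]

/-- The energy gained while `u` falls from `1` to `1 / 2` after `π / 4` is at least of order `ω`,
since `|v| ≥ ω / 4` there. -/
theorem IsShot.energy_gain (h : IsShot (toroForce M) (ω ^ 2) T d u v a)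
    (hT' : T < Real.pi / 2) (hM : 1 < M) (hω : 0 < ω) (hb : b < T)
    (hc₀ : 0 < c₀) (hcot : ∀ t ∈ Icc θs b, 2 * (Real.cos (2 * t) / Real.sin (2 * t)) ≤ -c₀)
    (hθ : Real.pi / 4 ≤ θs) (hCω : 4 * C ≤ ω) (hC : 0 < C)
    (hE : ω ^ 2 / 3 - C ^ 2 / 2 ≤ shotEnergy M (ω ^ 2) u v θs) (hu1 : 1 < u θs)
    {q : ℝ} (hq : q ∈ Icc θs b) (hv : ∀ t ∈ Ioo θs q, v t ≤ 0) (huq : u q ≤ 1 / 2) :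
    ω ^ 2 / 3 - C ^ 2 / 2 + c₀ * ω / 8 ≤ shotEnergy M (ω ^ 2) u v q := by
  have hpi := Real.pi_pos
  have hsub : Icc θs q ⊆ Ioo 0 T := fun s hs =>
    ⟨by linarith [hs.1], by linarith [hs.2, hq.2]⟩
  have hcont : ContinuousOn u (Icc θs q) :=
    h.continuousOn_u.mono fun s hs => ⟨(hsub hs).1.le, (hsub hs).2⟩
  have hmono := h.monotoneOn_energy hT' hM hb
  obtain ⟨r, hr, hur⟩ := intermediate_value_Icc' hq.1 hcont
    (show (1 / 2 : ℝ) ∈ Icc (u q) (u θs) from ⟨huq, by linarith⟩)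
  obtain ⟨s, hs, hus⟩ := intermediate_value_Icc' hr.1 (hcont.mono (Icc_subset_Icc_right hr.2))
    (show (1 : ℝ) ∈ Icc (u r) (u θs) from ⟨by linarith, hu1.le⟩)
  have hanti := h.antitoneOn_of_v_nonpos (p := θs) (q := q) (by linarith) (by linarith [hq.2]) hv
  have hsr : Icc s r ⊆ Icc θs q := Icc_subset_Icc hs.1 hr.2
  have hder : ∀ t ∈ Icc s r, HasDerivAt (fun t => shotEnergy M (ω ^ 2) u v t + c₀ * ω / 4 * u t)
      (-(2 * (Real.cos (2 * t) / Real.sin (2 * t))) * v t ^ 2 + c₀ * ω / 4 * v t) t := by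
    intro t ht
    have ht' := hsub (hsr ht)
    exact (h.hasDerivAt_energy' hM ht').add ((h.hasDerivAt_u t ⟨ht'.1.le, ht'.2⟩).const_mul _)
  have hm2 : MonotoneOn (fun t => shotEnergy M (ω ^ 2) u v t + c₀ * ω / 4 * u t) (Icc s r) := by
    refine monotoneOn_of_deriv_nonneg (convex_Icc _ _)
      (fun t ht => (hder t ht).continuousAt.continuousWithinAt)
      (fun t ht => (hder t (interior_subset ht)).differentiableAt.differentiableWithinAt)
      fun t ht => ?_
    have ht1 := interior_subset ht
    rw [(hder t ht1).deriv]
    rw [interior_Icc] at ht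
    have ht2 := hsr ht1
    have hu_le : u t ≤ 1 := hus ▸ hanti (hsr ⟨le_rfl, hs.2⟩) ht2 ht1.1
    have hu_ge : 1 / 2 ≤ u t := hur ▸ hanti ht2 hr ht1.2
    have hEt : ω ^ 2 / 3 - C ^ 2 / 2 ≤ shotEnergy M (ω ^ 2) u v t :=
      hE.trans (hmono ⟨hθ, hq.1.trans hq.2⟩ ⟨hθ.trans ht2.1, ht2.2.trans hq.2⟩ ht2.1)
    rw [shotEnergy, toroPotential_of_mem hM ⟨by linarith, by linarith⟩] at hEt
    have h4 : u t ^ 4 ≤ 1 := pow_le_one₀ (by linarith) hu_le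
    have h5 : 1 / 4 ≤ u t ^ 2 := by nlinarith
    have h6 : 1 / 12 ≤ u t ^ 2 / 2 - u t ^ 6 / 6 := by
      have : u t ^ 6 ≤ u t ^ 2 := by
        have e : u t ^ 6 = u t ^ 2 * u t ^ 4 := by ring
        rw [e]; nlinarith
      linarith
    have h7 : ω ^ 2 * (1 / 12) ≤ ω ^ 2 * (u t ^ 2 / 2 - u t ^ 6 / 6) := by gcongr
    have h8 : (ω / 4) ^ 2 ≤ (-v t) ^ 2 := by nlinarith
    have hvt : v t ≤ 0 := hv t ⟨hs.1.trans_lt ht.1, ht.2.trans_le hr.2⟩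
    have h9 : ω / 4 ≤ -v t := by
      exact (sq_le_sq₀ (by linarith) (by linarith)).1 h8
    have h10 := hcot t ⟨ht2.1, ht2.2.trans hq.2⟩
    nlinarith [mul_nonneg hc₀.le (mul_nonneg (by linarith : 0 ≤ -v t)
      (by linarith : 0 ≤ -v t - ω / 4)), sq_nonneg (v t)]
  have h1 := hm2 ⟨le_rfl, hs.2⟩ ⟨hs.2, le_rfl⟩ hs.2
  simp only [hur, hus] at h1
  have h2 : shotEnergy M (ω ^ 2) u v θs ≤ shotEnergy M (ω ^ 2) u v s :=
    hmono ⟨hθ, hq.1.trans hq.2⟩ ⟨hθ.trans hs.1, (hs.2.trans hr.2).trans hq.2⟩ hs.1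
  have h3 : shotEnergy M (ω ^ 2) u v r ≤ shotEnergy M (ω ^ 2) u v q :=
    hmono ⟨hθ.trans hr.1, hr.2.trans hq.2⟩ ⟨hθ.trans hq.1, hq.2⟩ hr.2
  linarith

/-- The constants of the argument: `M` bounds the solutions, `[π / 4, θs]` is where the solution
comes close to `0`, the descent takes place in `[θs, θp]`, and the frequency `ω` is large compared
with the bounds on the coefficient `2 cot (2t)` and with the number `k` of turns. -/
structure LargeFrequency (k : ℕ) (T M ω b C C₀ c₀ θs θp : ℝ) : Prop where
  pi_lt_T : Real.pi / 4 < T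
  T_lt : T < Real.pi / 2
  one_lt_M : 1 < M
  M_large : 1 / 3 < Real.sin (2 * T) ^ 2 * (M ^ 6 / 6 - M ^ 2 / 2 + 1 / 3)
  b_lt : b < T
  cot_le : ∀ t ∈ Icc (Real.pi / 4) b, |2 * (Real.cos (2 * t) / Real.sin (2 * t))| ≤ C₀
  c₀_pos : 0 < c₀
  cot_neg : ∀ t ∈ Icc θs b, 2 * (Real.cos (2 * t) / Real.sin (2 * t)) ≤ -c₀
  lt_θs : Real.pi / 4 < θs
  θs_lt : θs < θp
  θp_lt : θp < b
  C_pos : 0 < C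
  turns : 2 * Real.pi * k + Real.pi ≤ (C - C₀ / 2) * (θs - Real.pi / 4)
  half_turn : Real.pi ≤ (C - C₀ / 2) * (θp - θs)
  ω_pos : 0 < ω
  ω_ge : 4 * C ≤ ω
  gain_ge : 8 * C ^ 2 ≤ c₀ * ω
  speed_ge : 8 ≤ c₀ * ω * (b - θp) ^ 2

theorem LargeFrequency.div_mem (R : LargeFrequency k T M ω b C C₀ c₀ θs θp) :
    0 < C / ω ∧ C / ω ≤ 1 / 2 ∧ ω * (C / ω) = C := by
  have hω := R.ω_pos
  have hC := R.C_pos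
  refine ⟨by positivity, ?_, by field_simp⟩
  rw [div_le_iff₀ hω]; linarith [R.ω_ge]

theorem LargeFrequency.θs_mem (R : LargeFrequency k T M ω b C C₀ c₀ θs θp) : θs ∈ Ico 0 T :=
  ⟨by linarith [R.lt_θs, Real.pi_pos], by linarith [R.θs_lt, R.θp_lt, R.b_lt]⟩

theorem IsAngle.spike_facts (R : LargeFrequency k T M ω b C C₀ c₀ θs θp)
    (hφ : IsAngle ω b u v a φ)
    (h : IsShot (toroForce M) (ω ^ 2) T d u v a) (hd : d ∈ Ioo 0 1)
    (hi : φ θs = 2 * Real.pi * i) : v θs = 0 ∧ 1 < u θs := by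
  obtain ⟨ρ, hρ, hx, hy⟩ := hφ.polar h R.T_lt R.one_lt_M hd R.ω_pos R.b_lt (t := θs)
    ⟨R.θs_mem.1, (R.θs_lt.trans R.θp_lt).le⟩
  have hi' : φ θs = i * (2 * Real.pi) := by rw [hi]; ring
  constructor
  · rw [hy, hi', show (i : ℝ) * (2 * Real.pi) = ((2 * i : ℕ) : ℝ) * Real.pi by push_cast; ring,
      Real.sin_nat_mul_pi]
    simp
  · rw [hi', Real.cos_nat_mul_two_pi] at hx
    by_contra hcon
    nlinarith [R.ω_pos]

/-- If the spike number `i + 1` sits at `θs`, the energy there is nearly that of `u = 0`: since only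
`i` turns fit before `θs`, somewhere in `[π / 4, θs]` the solution is of size `C / ω`. -/
theorem IsAngle.energy_at_spike (R : LargeFrequency k T M ω b C C₀ c₀ θs θp)
    (hφ : IsAngle ω b u v a φ)
    (h : IsShot (toroForce M) (ω ^ 2) T d u v a) (hd : d ∈ Ioo 0 1)
    (hik : i < k) (hi : φ θs = 2 * Real.pi * i) :
    ω ^ 2 / 3 - C ^ 2 / 2 ≤ shotEnergy M (ω ^ 2) u v θs := by
  have hpi := Real.pi_pos
  have hω := R.ω_pos
  have hM := R.one_lt_M
  have hL : 0 < ω ^ 2 := by positivity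
  obtain ⟨hm0, hm2, hmω⟩ := R.div_mem
  have hθs := R.lt_θs
  have hsb : θs < b := R.θs_lt.trans R.θp_lt
  have hex1 : ∃ p ∈ Icc (Real.pi / 4) θs, u p < C / ω := by
    by_contra hcon
    push Not at hcon
    have h1 := hφ.rotation h R.pi_lt_T R.T_lt hM hd hω R.M_large R.b_lt R.cot_le le_rfl hθs.le
      hsb.le hm0 (by linarith) hcon
    rw [hmω] at h1
    have h2 := hφ.neg_pi_lt h hL R.T_lt hM hd hω R.b_lt (t := Real.pi / 4)
      ⟨by linarith, by linarith⟩
    have h3 : (i : ℝ) < k := by exact_mod_cast hik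
    have h4 : 2 * Real.pi * (i : ℝ) < 2 * Real.pi * k := by gcongr
    linarith [R.turns]
  obtain ⟨p, hp, hup⟩ := hex1
  have hp0 : 0 < u p := by
    by_contra hcon
    exact (h.v_neg_of_nonpos R.T_lt hM hd.1 ⟨by linarith [hp.1], hp.2.trans_lt R.θs_mem.2⟩
      (not_lt.1 hcon) θs ⟨hp.2, R.θs_mem.2⟩).ne (hφ.spike_facts R h hd hi).1
  refine le_trans ?_ (h.monotoneOn_energy R.T_lt hM R.b_lt ⟨hp.1, hp.2.trans hsb.le⟩
    ⟨hθs.le, hsb.le⟩ hp.2)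
  rw [shotEnergy, toroPotential_of_mem hM ⟨hp0.le, by linarith⟩]
  have h1 : ω * u p ≤ C := by
    rw [lt_div_iff₀ hω] at hup; linarith
  have h2 : (ω * u p) ^ 2 ≤ C ^ 2 := by gcongr
  have h3 := mul_pos hL (pow_pos hp0 6)
  rw [mul_pow] at h2
  linarith [sq_nonneg (v p)]

theorem IsAngle.lt_after_spike (R : LargeFrequency k T M ω b C C₀ c₀ θs θp)
    (hφ : IsAngle ω b u v a φ)
    (h : IsShot (toroForce M) (ω ^ 2) T d u v a) (hd : d ∈ Ioo 0 1)
    (hi : φ θs = 2 * Real.pi * i) {t : ℝ} (ht : t ∈ Ioc θs b) : 2 * Real.pi * i < φ t := by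
  have := hφ.lt_of_le h (pow_pos R.ω_pos 2) R.T_lt R.one_lt_M hd R.ω_pos R.b_lt R.θs_mem.1 ht.1
    ht.2 (n := 2 * i) (by push_cast; linarith)
  push_cast at this
  linarith

theorem IsAngle.v_neg_of_strip (R : LargeFrequency k T M ω b C C₀ c₀ θs θp)
    (hφ : IsAngle ω b u v a φ)
    (h : IsShot (toroForce M) (ω ^ 2) T d u v a) (hd : d ∈ Ioo 0 1) {t : ℝ} (ht : t ∈ Icc 0 b)
    (h1 : 2 * Real.pi * i < φ t) (h2 : φ t < 2 * Real.pi * i + Real.pi) : v t < 0 := by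
  obtain ⟨ρ, hρ, -, hy⟩ := hφ.polar h R.T_lt R.one_lt_M hd R.ω_pos R.b_lt ht
  rw [hy]
  exact neg_neg_of_pos (mul_pos hρ (sin_pos_of_mem_strip h1 h2))

/-- After the spike at `θs` there is no minimum: by the energy gain on the descent, its energy would
exceed that of `u = 0`. -/
theorem IsAngle.no_minimum (R : LargeFrequency k T M ω b C C₀ c₀ θs θp)
    (hφ : IsAngle ω b u v a φ)
    (h : IsShot (toroForce M) (ω ^ 2) T d u v a) (hd : d ∈ Ioo 0 1)
    (hik : i < k) (hi : φ θs = 2 * Real.pi * i) {t : ℝ} (ht : t ∈ Ioc θs b) :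
    φ t < 2 * Real.pi * i + Real.pi := by
  have hpi := Real.pi_pos
  have hω := R.ω_pos
  have hM := R.one_lt_M
  have hL : 0 < ω ^ 2 := by positivity
  have hθs := R.lt_θs
  have hsb : θs < b := R.θs_lt.trans R.θp_lt
  have hE := hφ.energy_at_spike R h hd hik hi
  obtain ⟨hvs, hus⟩ := hφ.spike_facts R h hd hi
  have hCω : 16 * C ^ 2 ≤ ω ^ 2 := by
    have : (4 * C) ^ 2 ≤ ω ^ 2 := by
      have := R.C_pos
      have := R.ω_ge
      gcongr
    linarith
  by_contra hcon
  obtain ⟨c, hc, hc0, hcneg⟩ := exists_first_zero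
    (g := fun s => φ s - (2 * Real.pi * i + Real.pi)) ht.1.le
    ((hφ.continuousOn.mono (Icc_subset_Icc R.θs_mem.1 ht.2)).sub continuousOn_const)
    (by rw [hi]; linarith) (by linarith [not_lt.1 hcon])
  have hcb : c ≤ b := hc.2.trans ht.2
  have hcI : c ∈ Icc 0 b := ⟨R.θs_mem.1.trans hc.1.le, hcb⟩
  have hφc : φ c = i * (2 * Real.pi) + Real.pi := by linarith
  obtain ⟨ρ, hρ, hx, hy⟩ := hφ.polar h R.T_lt hM hd hω R.b_lt hcI
  have hvc : v c = 0 := by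
    rw [hy, hφc, Real.sin_add_pi, show (i : ℝ) * (2 * Real.pi) = ((2 * i : ℕ) : ℝ) * Real.pi
      by push_cast; ring, Real.sin_nat_mul_pi]
    simp
  have huc1 : u c < 1 := by
    rw [hφc, Real.cos_add_pi, Real.cos_nat_mul_two_pi] at hx
    by_contra hcon
    nlinarith
  have huc0 := h.u_pos_of_v_eq_zero R.T_lt hM hd.1 ⟨hcI.1, hcb.trans_lt R.b_lt⟩ hvc
  have hEc := hE.trans (h.monotoneOn_energy R.T_lt hM R.b_lt ⟨hθs.le, hsb.le⟩
    ⟨hθs.le.trans hc.1.le, hcb⟩ hc.1.le)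
  have h6 : u c ^ 6 ≤ u c ^ 2 := pow_le_pow_of_le_one huc0.le huc1.le (by norm_num)
  have hEq : shotEnergy M (ω ^ 2) u v c
      = ω ^ 2 / 3 - ω ^ 2 * (u c ^ 2 / 2 - u c ^ 6 / 6) := by
    rw [shotEnergy, toroPotential_of_mem hM ⟨huc0.le, by linarith⟩, hvc]; ring
  have huc2 : u c ≤ 1 / 2 := by
    rw [hEq] at hEc
    by_contra hcon
    have h7 : 1 / 4 < u c ^ 2 := by nlinarith
    have h8 : ω ^ 2 * (1 / 12) < ω ^ 2 * (u c ^ 2 / 2 - u c ^ 6 / 6) := by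
      apply mul_lt_mul_of_pos_left _ hL
      linarith
    linarith
  have hgain := h.energy_gain R.T_lt hM hω R.b_lt R.c₀_pos R.cot_neg hθs.le R.ω_ge R.C_pos hE hus
    (q := c) ⟨hc.1.le, hcb⟩ (fun s hs => (hφ.v_neg_of_strip R h hd
      ⟨R.θs_mem.1.trans hs.1.le, hs.2.le.trans hcb⟩
      (hφ.lt_after_spike R h hd hi ⟨hs.1, hs.2.le.trans hcb⟩)
      (by linarith [hcneg s ⟨hs.1.le, hs.2⟩])).le) huc2
  rw [hEq] at hgain
  have h9 : 0 < u c ^ 2 := by positivity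
  linarith [mul_nonneg hL.le (by linarith : 0 ≤ u c ^ 2 / 2 - u c ^ 6 / 6),
    mul_pos R.c₀_pos hω, R.gain_ge, pow_pos R.C_pos 2]

/-- A solution with spike number `i + 1` at `θs` crosses zero between that spike and `b`, without
another critical point: the descent makes the energy larger than that of `u = 0`, so that the
speed stays bounded below until the crossing. -/
theorem IsAngle.crosses_zero (R : LargeFrequency k T M ω b C C₀ c₀ θs θp)
    (hφ : IsAngle ω b u v a φ)
    (h : IsShot (toroForce M) (ω ^ 2) T d u v a) (hd : d ∈ Ioo 0 1)
    (hik : i < k) (hi : φ θs = 2 * Real.pi * i) :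
    u b < 0 ∧ 2 * Real.pi * i < φ b ∧ φ b < 2 * Real.pi * i + Real.pi := by
  have hpi := Real.pi_pos
  have hω := R.ω_pos
  have hM := R.one_lt_M
  have hL : 0 < ω ^ 2 := by positivity
  have hθs := R.lt_θs
  have hpb := R.θp_lt
  have hb := R.b_lt
  have hsb : θs < b := R.θs_lt.trans R.θp_lt
  obtain ⟨hm0, hm2, hmω⟩ := R.div_mem
  have hE := hφ.energy_at_spike R h hd hik hi
  obtain ⟨hvs, hus⟩ := hφ.spike_facts R h hd hi
  have hmono := h.monotoneOn_energy R.T_lt hM hb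
  have hlt : ∀ t ∈ Ioc θs b, φ t < 2 * Real.pi * i + Real.pi := fun t ht =>
    hφ.no_minimum R h hd hik hi ht
  have hvneg : ∀ t ∈ Ioc θs b, v t < 0 := fun t ht => hφ.v_neg_of_strip R h hd
      ⟨R.θs_mem.1.trans ht.1.le, ht.2⟩ (hφ.lt_after_spike R h hd hi ht) (hlt t ht)
  refine ⟨?_, hφ.lt_after_spike R h hd hi ⟨hsb, le_rfl⟩, hlt b ⟨hsb, le_rfl⟩⟩
  by_contra hub
  have hub := not_lt.1 hub
  obtain ⟨q, hq, huq⟩ : ∃ q ∈ Icc θs θp, u q < C / ω := by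
    by_contra hcon
    push Not at hcon
    have h1 := hφ.rotation h R.pi_lt_T R.T_lt hM hd hω R.M_large hb R.cot_le hθs.le R.θs_lt.le
      hpb.le hm0 (by linarith) hcon
    rw [hmω] at h1
    linarith [hlt θp ⟨R.θs_lt, hpb.le⟩, R.half_turn]
  have hqb : q < b := hq.2.trans_lt hpb
  have hgain := h.energy_gain R.T_lt hM hω hb R.c₀_pos R.cot_neg hθs.le R.ω_ge R.C_pos hE hus
    (q := q) ⟨hq.1, hqb.le⟩ (fun s hs => (hvneg s ⟨hs.1, hs.2.le.trans hqb.le⟩).le) (by linarith)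
  have hanti := h.antitoneOn_of_v_nonpos (p := θs) (q := b) R.θs_mem.1 hb
    (fun s hs => (hvneg s ⟨hs.1, hs.2.le⟩).le)
  -- With energy above that of `u = 0` the solution falls with speed at least `s`, which would
  -- take it by `1` further down before `b`.
  set s := (b - θp)⁻¹ with hs
  have hs0 : 0 < s := inv_pos.2 (by linarith)
  have hs1 : s * (b - θp) = 1 := inv_mul_cancel₀ (by linarith)
  have hs2 : 8 * s ^ 2 ≤ c₀ * ω := by
    have := mul_le_mul_of_nonneg_right R.speed_ge (sq_nonneg s)
    have e : c₀ * ω * (b - θp) ^ 2 * s ^ 2 = c₀ * ω * (s * (b - θp)) ^ 2 := by ring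
    rw [e, hs1] at this
    linarith
  have hspeed : ∀ t ∈ interior (Icc q b), deriv u t ≤ -s := by
    intro t ht
    rw [interior_Icc] at ht
    have htI : t ∈ Icc θs b := ⟨hq.1.trans ht.1.le, ht.2.le⟩
    have htI' : t ∈ Ioc θs b := ⟨hq.1.trans_lt ht.1, ht.2.le⟩
    rw [h.deriv_u ⟨by linarith [htI.1], by linarith [htI.2]⟩]
    have hv := hvneg t htI'
    have hu0 : 0 ≤ u t := hub.trans (hanti htI ⟨hsb.le, le_rfl⟩ ht.2.le)
    have hu1 : u t ≤ 1 / 2 := (hanti ⟨hq.1, hqb.le⟩ htI ht.1.le).trans (by linarith)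
    have hEt := hgain.trans (hmono ⟨hθs.le.trans hq.1, hqb.le⟩ ⟨hθs.le.trans htI.1, htI.2⟩ ht.1.le)
    rw [shotEnergy, toroPotential_of_mem hM ⟨hu0, by linarith⟩] at hEt
    have h6 : u t ^ 6 ≤ u t ^ 2 := pow_le_pow_of_le_one hu0 (by linarith) (by norm_num)
    have h7 : ω ^ 2 * (u t ^ 6 / 6 - u t ^ 2 / 2 + 1 / 3) ≤ ω ^ 2 * (1 / 3) := by
      apply mul_le_mul_of_nonneg_left _ hL.le
      linarith [sq_nonneg (u t)]
    have h8 : s ^ 2 ≤ (-v t) ^ 2 := by rw [neg_sq]; linarith [R.gain_ge]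
    have h9 : s ≤ -v t := (sq_le_sq₀ (by linarith) (by linarith)).1 h8
    linarith
  have hsub : Icc q b ⊆ Ico 0 T := fun t ht => ⟨by linarith [ht.1, hq.1], by linarith [ht.2]⟩
  have h1 := (convex_Icc q b).image_sub_le_mul_sub_of_deriv_le (h.continuousOn_u.mono hsub)
    (fun t ht => (h.hasDerivAt_u t (hsub (interior_subset ht))).differentiableAt
      |>.differentiableWithinAt) hspeed q ⟨le_rfl, hqb.le⟩ b ⟨hqb.le, le_rfl⟩ hqb.le
  have h2 : s * (b - θp) ≤ s * (b - q) := by gcongr; exact hq.2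
  linarith

/-- A solution that stays below `1` increases: the angle stays in `(-π, -π / 2)`. -/
theorem IsAngle.of_lt_one {L : ℝ} (hφ : IsAngle ω b u v a φ)
    (h : IsShot (toroForce M) L T d u v a) (hL : 0 < L)
    (hT' : T < Real.pi / 2) (hM : 1 < M) (hd : d ∈ Ioo 0 1) (hω : 0 < ω) (hb0 : 0 < b) (hb : b < T)
    (hu : ∀ t ∈ Icc 0 b, u t < 1) : (∀ t ∈ Icc 0 b, φ t < 0) ∧ 0 < u b := by
  have hpi := Real.pi_pos
  have hlt : ∀ t ∈ Icc 0 b, φ t < -(Real.pi / 2) := by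
    intro t ht
    by_contra hcon
    obtain ⟨c, hc, hc0, -⟩ := exists_first_zero (g := fun s => φ s + Real.pi / 2) ht.1
      ((hφ.continuousOn.mono (Icc_subset_Icc_right ht.2)).add continuousOn_const)
      (by rw [hφ.zero]; linarith) (by linarith [not_lt.1 hcon])
    have hc' : c ∈ Icc 0 b := ⟨hc.1.le, hc.2.trans ht.2⟩
    obtain ⟨ρ, hρ, hx, -⟩ := hφ.polar h hT' hM hd hω hb hc'
    rw [show φ c = -(Real.pi / 2) by linarith, Real.cos_neg, Real.cos_pi_div_two] at hx
    nlinarith [hu c hc']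
  refine ⟨fun t ht => by linarith [hlt t ht], ?_⟩
  by_contra hcon
  have hv := h.v_neg_of_nonpos hT' hM hd.1 ⟨hb0.le, hb⟩ (not_lt.1 hcon) b ⟨le_rfl, hb⟩
  obtain ⟨ρ, hρ, -, hy⟩ := hφ.polar h hT' hM hd hω hb (t := b) ⟨hb0.le, le_rfl⟩
  have h1 := hφ.neg_pi_lt h hL hT' hM hd hω hb (t := b) ⟨hb0, le_rfl⟩
  have h2 : Real.sin (φ b) < 0 := Real.sin_neg_of_neg_of_neg_pi_lt
    (by linarith [hlt b ⟨hb0.le, le_rfl⟩]) h1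
  nlinarith

/-- With `ψ d` the final angle for the initial value `d`: since `v b < 0` means `0 < sin (ψ d)`, the
final angle stays in one strip as long as the final velocity is negative. -/
theorem strip_of_sin_pos {ψ : ℝ → ℝ} {s : Set ℝ} (hs : IsPreconnected s) (hψ : ContinuousOn ψ s)
    (hsin : ∀ x ∈ s, 0 < Real.sin (ψ x)) {x y : ℝ} (hx : x ∈ s) (hy : y ∈ s)
    (h1 : 2 * Real.pi * i < ψ x) (h2 : ψ x < 2 * Real.pi * i + Real.pi) :
    2 * Real.pi * i < ψ y ∧ ψ y < 2 * Real.pi * i + Real.pi := by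
  have himg := (hs.image ψ hψ).ordConnected
  have hz : Real.sin (2 * Real.pi * i) = 0 := by
    rw [show 2 * Real.pi * i = ((2 * i : ℕ) : ℝ) * Real.pi by push_cast; ring,
      Real.sin_nat_mul_pi]
  constructor
  · by_contra hcon
    obtain ⟨z, hz1, hz2⟩ := himg.out (mem_image_of_mem ψ hy) (mem_image_of_mem ψ hx)
      ⟨not_lt.1 hcon, h1.le⟩
    have := hsin z hz1
    rw [hz2, hz] at this
    exact lt_irrefl _ this
  · by_contra hcon
    obtain ⟨z, hz1, hz2⟩ := himg.out (mem_image_of_mem ψ hx) (mem_image_of_mem ψ hy)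
      ⟨h2.le, not_lt.1 hcon⟩
    have := hsin z hz1
    rw [hz2, Real.sin_add_pi, hz] at this
    simp at this

end LargeFrequency

/-! ### Variation of the initial value -/

/-- A family of solutions depending continuously on the initial value has, over a compact range of
initial values, angles whose values at each time depend continuously on the initial value. -/
theorem exists_angles {T M ω b d₀ d₁ : ℝ} (hT' : T < Real.pi / 2) (hM : 1 < M) (hω : 0 < ω)
    {L : ℝ} {U V A : ℝ → ℝ → ℝ} (hU : Continuous fun p : ℝ × ℝ => U p.1 p.2)
    (hV : Continuous fun p : ℝ × ℝ => V p.1 p.2) (hA : Continuous fun p : ℝ × ℝ => A p.1 p.2)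
    (hshot : ∀ d, IsShot (toroForce M) L T d (U d) (V d) (A d))
    (hd : d₀ ≤ d₁) (hd₁ : d₁ < 1) (hb0 : 0 ≤ b) (hb : b < T) :
    ∃ φ : ℝ → ℝ → ℝ, (∀ t, Continuous fun d => φ d t) ∧
      ∀ d ∈ Icc d₀ d₁, IsAngle ω b (U d) (V d) (A d) (φ d) := by
  let c : ℝ × ℝ → ℝ × ℝ := fun p => ((projIcc d₀ d₁ hd p.1 : ℝ), (projIcc 0 b hb0 p.2 : ℝ))
  have hc : Continuous c := by
    have h1 : Continuous fun x => (projIcc d₀ d₁ hd x : ℝ) :=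
      continuous_subtype_val.comp continuous_projIcc
    have h2 : Continuous fun x => (projIcc 0 b hb0 x : ℝ) :=
      continuous_subtype_val.comp continuous_projIcc
    exact (h1.comp continuous_fst).prodMk (h2.comp continuous_snd)
  have hcmem : ∀ p, c p ∈ Icc d₀ d₁ ×ˢ Icc 0 b := fun p =>
    ⟨(projIcc d₀ d₁ hd p.1).2, (projIcc 0 b hb0 p.2).2⟩
  have hF : ContinuousOn (fun q : ℝ × ℝ => angularSpeed ω (U q.1) (V q.1) (A q.1) q.2)
      (Icc d₀ d₁ ×ˢ Icc 0 b) := by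
    unfold angularSpeed
    refine ContinuousOn.div (Continuous.continuousOn (by fun_prop))
      (Continuous.continuousOn (by fun_prop)) fun q hq => ?_
    exact ((hshot q.1).denominator_pos hT' hM (hq.1.2.trans_lt hd₁).ne hω
      ⟨hq.2.1, hq.2.2.trans_lt hb⟩).ne'
  have hFc := hF.comp_continuous hc hcmem
  generalize hN : (fun d t => angularSpeed ω (U (c (d, t)).1) (V (c (d, t)).1) (A (c (d, t)).1)
    (c (d, t)).2 : ℝ → ℝ → ℝ) = N
  have hNc : Continuous N.uncurry := by rw [← hN]; exact hFc
  refine ⟨fun d θ => -Real.pi + ∫ t in (0 : ℝ)..θ, N d t, fun t => continuous_const.add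
    (intervalIntegral.continuous_parametric_intervalIntegral_of_continuous' hNc 0 t), ?_⟩
  intro d hdI
  refine ⟨by simp, fun t ht => ?_⟩
  have hNd : Continuous (N d) := hNc.comp (by fun_prop : Continuous fun t : ℝ => (d, t))
  refine ((hNd.integral_hasStrictDerivAt 0 t).hasDerivAt.const_add (-Real.pi)).congr_deriv ?_
  have hct : c (d, t) = (d, t) := by
    simp only [c]
    rw [projIcc_of_mem hd hdI, projIcc_of_mem hb0 ht]
  rw [← hN]
  simp only [hct]

/-- The last zero of a function that is nonnegative at `a` and negative at `b`. -/
theorem exists_last_zero {g : ℝ → ℝ} {a b : ℝ} (hab : a ≤ b) (hg : ContinuousOn g (Icc a b))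
    (ha : 0 ≤ g a) (hb : g b < 0) :
    ∃ c ∈ Ico a b, g c = 0 ∧ ∀ t ∈ Ioc c b, g t < 0 := by
  obtain ⟨c, hc, hc0, hneg⟩ := exists_first_zero (g := fun s => g (-s)) (a := -b) (b := -a)
    (by linarith) (hg.comp continuousOn_neg fun s hs => ⟨by linarith [hs.2], by linarith [hs.1]⟩)
    (by simpa using hb) (by simpa using ha)
  exact ⟨-c, ⟨by linarith [hc.2], by linarith [hc.1]⟩, hc0, fun t ht => by
    have := hneg (-t) ⟨by linarith [ht.2], by linarith [ht.1]⟩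
    simpa using this⟩

/-- Continuity in the initial value, uniformly on compact time intervals. -/
theorem eventually_forall_mem_Icc {U : ℝ → ℝ → ℝ} (hU : Continuous fun p : ℝ × ℝ => U p.1 p.2)
    {s : Set ℝ} (hs : IsOpen s) {d₀ b : ℝ} (h : ∀ t ∈ Icc 0 b, U d₀ t ∈ s) :
    ∀ᶠ d in 𝓝 d₀, ∀ t ∈ Icc 0 b, U d t ∈ s :=
  isCompact_Icc.eventually_forall_of_forall_eventually fun t ht =>
    hU.continuousAt.eventually (hs.mem_nhds (h t ht))

/-- Two solutions with `i + 1` spikes: in the initial value `d`, the end value `U d b` is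
nonnegative near `0` and near `1`, and negative for the solution whose spike number `i + 1` sits at
`θs`; the nearest zeros of `d ↦ U d b` on both sides belong to the two solutions. -/
theorem LargeFrequency.exists_two {k i : ℕ} {T M ω b C C₀ c₀ θs θp : ℝ}
    (R : LargeFrequency k T M ω b C C₀ c₀ θs θp) {U V A : ℝ → ℝ → ℝ}
    (hU : Continuous fun p : ℝ × ℝ => U p.1 p.2)
    (hV : Continuous fun p : ℝ × ℝ => V p.1 p.2) (hA : Continuous fun p : ℝ × ℝ => A p.1 p.2)
    (hshot : ∀ d, IsShot (toroForce M) (ω ^ 2) T d (U d) (V d) (A d))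
    (hconst : ∀ c, toroForce M c = 0 → ∀ t ∈ Icc 0 T, U c t = c) (hik : i < k) :
    ∃ d ∈ Ioo (0 : ℝ) 1, ∃ d' ∈ Ioo (0 : ℝ) 1, d < d' ∧
      (IsToroSolution (-ω ^ 2) b (U d) ∧ (spikes b (U d)).encard = ((i + 1 : ℕ) : ℕ∞)) ∧
      (IsToroSolution (-ω ^ 2) b (U d') ∧ (spikes b (U d')).encard = ((i + 1 : ℕ) : ℕ∞)) := by
  have hpi := Real.pi_pos
  have hω := R.ω_pos
  have hM := R.one_lt_M
  have hT' := R.T_lt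
  have hb := R.b_lt
  have hL : 0 < ω ^ 2 := by positivity
  have hθs := R.lt_θs
  have hsb : θs < b := R.θs_lt.trans R.θp_lt
  have hb0 : 0 < b := by linarith
  have hsubT : Icc 0 b ⊆ Icc 0 T := Icc_subset_Icc_right hb.le
  -- Initial values near `0` and near `1`.
  obtain ⟨d₀, hd₀, hd₀'⟩ : ∃ d₀ ∈ Ioo (0 : ℝ) (1 / 2), ∀ t ∈ Icc 0 b, U d₀ t ∈ Iio 1 := by
    have h1 := eventually_forall_mem_Icc hU isOpen_Iio (d₀ := 0) (b := b) (s := Iio 1) fun t ht => by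
      rw [hconst 0 (toroForce_of_nonpos le_rfl) t (hsubT ht)]; exact mem_Iio.2 one_pos
    have h2 : ∀ᶠ d in 𝓝[>] (0 : ℝ), d ∈ Ioo (0 : ℝ) (1 / 2) := Ioo_mem_nhdsGT (by norm_num)
    obtain ⟨d, hd1, hd2⟩ := ((h1.filter_mono nhdsWithin_le_nhds).and h2).exists
    exact ⟨d, hd2, hd1⟩
  obtain ⟨d₁, hd₁, hd₁'⟩ : ∃ d₁ ∈ Ioo (1 / 2 : ℝ) 1, ∀ t ∈ Icc 0 b, U d₁ t ∈ Ioi (1 / 2) := by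
    have h1 := eventually_forall_mem_Icc hU isOpen_Ioi (d₀ := 1) (b := b) (s := Ioi (1 / 2))
      fun t ht => by
        rw [hconst 1 (toroForce_one hM) t (hsubT ht)]; exact mem_Ioi.2 one_half_lt_one
    have h2 : ∀ᶠ d in 𝓝[<] (1 : ℝ), d ∈ Ioo (1 / 2 : ℝ) 1 := Ioo_mem_nhdsLT (by norm_num)
    obtain ⟨d, hd1, hd2⟩ := ((h1.filter_mono nhdsWithin_le_nhds).and h2).exists
    exact ⟨d, hd2, hd1⟩
  have hd01 : d₀ ≤ d₁ := by linarith [hd₀.2, hd₁.1]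
  have hIoo : ∀ d ∈ Icc d₀ d₁, d ∈ Ioo (0 : ℝ) 1 := fun d hd =>
    ⟨hd₀.1.trans_le hd.1, hd.2.trans_lt hd₁.2⟩
  obtain ⟨φ, hφc, hφ⟩ := exists_angles hT' hM hω hU hV hA hshot hd01 hd₁.2 hb0.le hb
  have hm0 : d₀ ∈ Icc d₀ d₁ := ⟨le_rfl, hd01⟩
  have hm1 : d₁ ∈ Icc d₀ d₁ := ⟨hd01, le_rfl⟩
  obtain ⟨hφ0, hU0⟩ := (hφ d₀ hm0).of_lt_one (hshot d₀) hL hT' hM (hIoo d₀ hm0) hω hb0 hb hd₀'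
  have hφ1 : 2 * Real.pi * k ≤ φ d₁ θs := by
    have h1 := (hφ d₁ hm1).rotation (hshot d₁) R.pi_lt_T hT' hM (hIoo d₁ hm1) hω R.M_large hb
      R.cot_le le_rfl hθs.le hsb.le (m := 1 / 2) (by norm_num) (by norm_num)
      (fun t ht => (hd₁' t ⟨by linarith [ht.1], ht.2.trans hsb.le⟩).le)
    have h2 := (hφ d₁ hm1).neg_pi_lt (hshot d₁) hL hT' hM (hIoo d₁ hm1) hω hb (t := Real.pi / 4)
      ⟨by linarith, by linarith⟩
    have h3 : (C - C₀ / 2) * (θs - Real.pi / 4) ≤ (ω * (1 / 2) - C₀ / 2) * (θs - Real.pi / 4) := by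
      apply mul_le_mul_of_nonneg_right _ (by linarith)
      linarith [R.ω_ge, R.C_pos]
    linarith [R.turns]
  obtain ⟨δ, hδ, hδi⟩ : ∃ δ ∈ Icc d₀ d₁, φ δ θs = 2 * Real.pi * i := by
    refine intermediate_value_Icc hd01 (hφc θs).continuousOn ⟨?_, ?_⟩
    · have h1 := hφ0 θs ⟨by linarith, hsb.le⟩
      have h2 : 0 ≤ 2 * Real.pi * (i : ℝ) := by positivity
      linarith
    · have h3 : (i : ℝ) < k := by exact_mod_cast hik
      refine le_trans ?_ hφ1
      gcongr
  obtain ⟨hδb, hδ1, hδ2⟩ := (hφ δ hδ).crosses_zero R (hshot δ) (hIoo δ hδ) hik hδi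
  have hUb : Continuous fun d => U d b := hU.comp (by fun_prop : Continuous fun d : ℝ => (d, b))
  obtain ⟨p, hp, hp0, hpneg⟩ := exists_last_zero hδ.1 hUb.continuousOn hU0.le hδb
  obtain ⟨q, hq, hq0, hqneg⟩ := exists_first_zero hδ.2 hUb.continuousOn hδb
    (by have h : 1 / 2 < U d₁ b := hd₁' b ⟨hb0.le, le_rfl⟩
        linarith)
  have hpI : p ∈ Icc d₀ d₁ := ⟨hp.1, by linarith [hp.2, hδ.2]⟩
  have hqI : q ∈ Icc d₀ d₁ := ⟨by linarith [hq.1, hδ.1], hq.2⟩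
  have hnonpos : ∀ d ∈ Icc p q, U d b ≤ 0 := by
    intro d hd
    rcases le_total d δ with h | h
    · rcases eq_or_lt_of_le hd.1 with rfl | h'
      · exact hp0.le
      · exact (hpneg d ⟨h', h⟩).le
    · rcases eq_or_lt_of_le hd.2 with rfl | h'
      · exact hq0.le
      · exact (hqneg d ⟨h, h'⟩).le
  have hsin : ∀ d ∈ Icc p q, 0 < Real.sin (φ d b) := by
    intro d hd
    have hdI : d ∈ Icc d₀ d₁ := ⟨hpI.1.trans hd.1, hd.2.trans hqI.2⟩
    have hv := (hshot d).v_neg_of_nonpos hT' hM (hIoo d hdI).1 ⟨hb0.le, hb⟩ (hnonpos d hd) b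
      ⟨le_rfl, hb⟩
    obtain ⟨ρ, hρ, -, hy⟩ := (hφ d hdI).polar (hshot d) hT' hM (hIoo d hdI) hω hb (t := b)
      ⟨hb0.le, le_rfl⟩
    rw [hy] at hv
    exact pos_of_mul_pos_right (by linarith) hρ.le
  have hpq : p < q := hp.2.trans hq.1
  have hres : ∀ d ∈ Icc p q, U d b = 0 → IsToroSolution (-ω ^ 2) b (U d) ∧
      (spikes b (U d)).encard = ((i + 1 : ℕ) : ℕ∞) := by
    intro d hd hd0
    have hdI : d ∈ Icc d₀ d₁ := ⟨hpI.1.trans hd.1, hd.2.trans hqI.2⟩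
    have hAd : Continuous (A d) := hA.comp (by fun_prop : Continuous fun t : ℝ => (d, t))
    obtain ⟨h1, h2⟩ := strip_of_sin_pos isPreconnected_Icc (hφc b).continuousOn hsin
      ⟨hp.2.le, hq.1.le⟩ hd hδ1 hδ2
    exact ⟨(hshot d).isToroSolution R.pi_lt_T hT' hM hL (hIoo d hdI) R.M_large hb0 hb hAd hd0,
      (hφ d hdI).encard_spikes (hshot d) hL hT' hM (hIoo d hdI) hω hb0 hb h1 h2⟩
  exact ⟨p, hIoo p hpI, q, hIoo q hqI, hpq, hres p ⟨le_rfl, hpq.le⟩ hp0, hres q ⟨hpq.le, le_rfl⟩ hq0⟩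

/-- Admissible constants exist for all large `ω`. -/
theorem exists_largeFrequency (k : ℕ) {b : ℝ} (hb : Real.pi / 4 < b) (hb' : b < Real.pi / 2) :
    ∃ T M C C₀ c₀ θs θp Ω : ℝ, 0 < Ω ∧
      ∀ ω, Ω ≤ ω → LargeFrequency k T M ω b C C₀ c₀ θs θp := by
  have hpi := Real.pi_pos
  set T := (b + Real.pi / 2) / 2 with hTdef
  set θs := (Real.pi / 4 + b) / 2 with hθsdef
  set θp := (θs + b) / 2 with hθpdef
  have hT : Real.pi / 4 < T := by linarith
  have hT' : T < Real.pi / 2 := by linarith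
  have hbT : b < T := by linarith
  have hθs : Real.pi / 4 < θs := by linarith
  have hθp : θs < θp := by linarith
  have hpb : θp < b := by linarith
  have hsin : 0 < Real.sin (2 * T) := Real.sin_pos_of_pos_of_lt_pi (by linarith) (by linarith)
  have hcont : ContinuousOn (fun t => 2 * (Real.cos (2 * t) / Real.sin (2 * t)))
      (Icc (Real.pi / 4) b) :=
    continuousOn_const.mul (ContinuousOn.div (by fun_prop) (by fun_prop)
      fun t ht => (sin_two_mul_pos hT' ⟨by linarith [ht.1], ht.2.trans_lt hbT⟩).ne')
  obtain ⟨C₀, hC₀⟩ := isCompact_Icc.exists_bound_of_continuousOn hcont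
  obtain ⟨z, hz, hzmax⟩ := isCompact_Icc.exists_isMaxOn (nonempty_Icc.2 (by linarith : θs ≤ b))
    (hcont.mono (Icc_subset_Icc_left hθs.le))
  set c₀ := -(2 * (Real.cos (2 * z) / Real.sin (2 * z))) with hc₀def
  have hc₀ : 0 < c₀ := by
    have h1 : Real.cos (2 * z) < 0 := Real.cos_neg_of_pi_div_two_lt_of_lt
      (by linarith [hz.1]) (by linarith [hz.2])
    have h2 := sin_two_mul_pos hT' (t := z) ⟨by linarith [hz.1], hz.2.trans_lt hbT⟩
    have := div_neg_of_neg_of_pos h1 h2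
    linarith
  obtain ⟨M, hM, hMT⟩ : ∃ M : ℝ, 1 < M ∧
      1 / 3 < Real.sin (2 * T) ^ 2 * (M ^ 6 / 6 - M ^ 2 / 2 + 1 / 3) := by
    refine ⟨2 + 1 / Real.sin (2 * T) ^ 2, by linarith [div_pos one_pos (pow_pos hsin 2)], ?_⟩
    set s := Real.sin (2 * T) ^ 2 with hs
    have hs0 : 0 < s := by positivity
    set M := 2 + 1 / s with hMdef
    have hM2 : 2 ≤ M := by linarith [div_pos one_pos hs0]
    have h1 : M ≤ M ^ 6 / 6 - M ^ 2 / 2 + 1 / 3 := by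
      have h4 : 16 ≤ M ^ 4 := by
        have : (2 : ℝ) ^ 4 ≤ M ^ 4 := by gcongr
        linarith
      have : M ^ 6 = M ^ 4 * M ^ 2 := by ring
      rw [this]
      nlinarith
    have h2 : s * M = 2 * s + 1 := by rw [hMdef]; field_simp
    have h3 := mul_le_mul_of_nonneg_left h1 hs0.le
    linarith
  set C := |C₀| / 2 + (2 * Real.pi * k + Real.pi) / (θs - Real.pi / 4)
    + Real.pi / (θp - θs) with hCdef
  have e1 : 0 < (2 * Real.pi * k + Real.pi) / (θs - Real.pi / 4) :=
    div_pos (by positivity) (by linarith)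
  have e2 : 0 < Real.pi / (θp - θs) := div_pos hpi (by linarith)
  have hC : 0 < C := by positivity
  have habs : C₀ ≤ |C₀| := le_abs_self _
  refine ⟨T, M, C, C₀, c₀, θs, θp, 4 * C + 8 * C ^ 2 / c₀ + 8 / (c₀ * (b - θp) ^ 2), ?_, ?_⟩
  · positivity
  intro ω hω
  have hbp : 0 < b - θp := by linarith
  have g1 : 0 < 8 * C ^ 2 / c₀ := by positivity
  have g2 : 0 < 8 / (c₀ * (b - θp) ^ 2) := by positivity
  refine ⟨hT, hT', hM, hMT, hbT, hC₀, hc₀, fun t ht => ?_, hθs, hθp, hpb, hC, ?_, ?_, by linarith,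
    by linarith, ?_, ?_⟩
  · rw [hc₀def, neg_neg]
    exact hzmax ht
  · rw [← div_le_iff₀ (by linarith)]; linarith
  · rw [← div_le_iff₀ (by linarith)]; linarith
  · rw [← div_le_iff₀' hc₀]; linarith
  · have : 8 / (c₀ * (b - θp) ^ 2) ≤ ω := by linarith
    rw [div_le_iff₀ (by positivity)] at this
    linarith

theorem spikes_congr {u w : ℝ → ℝ} {b : ℝ} (h : EqOn u w (Icc 0 b)) :
    spikes b u = spikes b w := by
  ext t
  refine and_congr_right fun ht => ?_
  have : u =ᶠ[𝓝 t] w := by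
    filter_upwards [Icc_mem_nhds ht.1 ht.2] with s hs
    exact h hs
  exact ⟨fun hm => hm.congr this, fun hm => hm.congr this.symm⟩

theorem toroSpikeSolutions_subset (lam b : ℝ) (j : ℕ) :
    toroSpikeSolutions lam b j ⊆ toroSolutions lam b := by
  rintro v ⟨u, h1, h2, -, h3⟩
  exact ⟨u, h1, h2, h3⟩

theorem disjoint_toroSpikeSolutions (lam b : ℝ) {i j : ℕ} (hij : i ≠ j) :
    Disjoint (toroSpikeSolutions lam b i) (toroSpikeSolutions lam b j) := by
  rw [Set.disjoint_left]
  rintro v ⟨u, -, -, hu, rfl⟩ ⟨w, -, -, hw, huw⟩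
  have heq : EqOn u w (Icc 0 b) := fun t ht => (congrFun huw ⟨t, ht⟩).symm
  rw [spikes_congr heq, hw] at hu
  exact hij (by exact_mod_cast hu.symm)

theorem two_mul_le_encard_toroSolutions {lam b : ℝ} {k : ℕ}
    (h : ∀ j : ℕ, 1 ≤ j → j ≤ k → 2 ≤ (toroSpikeSolutions lam b j).encard) :
    ((2 * k : ℕ) : ℕ∞) ≤ (toroSolutions lam b).encard := by
  have key : ∀ n ≤ k, ((2 * n : ℕ) : ℕ∞) ≤
      (⋃ j ∈ Icc 1 n, toroSpikeSolutions lam b j).encard := by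
    intro n
    induction n with
    | zero => simp
    | succ n ih =>
      intro hn
      have hunion : (⋃ j ∈ Icc 1 (n + 1), toroSpikeSolutions lam b j)
          = (⋃ j ∈ Icc 1 n, toroSpikeSolutions lam b j) ∪ toroSpikeSolutions lam b (n + 1) := by
        rw [← Set.insert_Icc_right_eq_Icc_add_one (by omega), biUnion_insert, union_comm]
      rw [hunion, Set.encard_union_eq]
      · have h1 := add_le_add (ih (by omega)) (h (n + 1) (by omega) hn)
        refine le_trans (le_of_eq ?_) h1
        push_cast; ring
      · rw [Set.disjoint_iUnion₂_left]
        intro j hj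
        exact disjoint_toroSpikeSolutions lam b (by have := hj.2; omega)
  refine (key k le_rfl).trans (Set.encard_le_encard ?_)
  exact iUnion₂_subset fun j _ => toroSpikeSolutions_subset lam b j

theorem theorem1p3 (k : ℕ) (hk : 1 ≤ k) (θ₁ : ℝ) (hθ₁ : Real.pi / 4 < θ₁)
    (hθ₁' : θ₁ < Real.pi / 2) :
    ∃ A : ℝ, 0 < A ∧ ∀ lam : ℝ, lam < -A →
      ((2 * k : ℕ) : ℕ∞) ≤ (toroSolutions lam θ₁).encard ∧
      ∀ j : ℕ, 1 ≤ j → j ≤ k → 2 ≤ (toroSpikeSolutions lam θ₁ j).encard := by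
  obtain ⟨T, M, C, C₀, c₀, θs, θp, Ω, hΩ, hR⟩ := exists_largeFrequency k hθ₁ hθ₁'
  refine ⟨Ω ^ 2, by positivity, fun lam hlam => ?_⟩
  have hmain : ∀ j : ℕ, 1 ≤ j → j ≤ k → 2 ≤ (toroSpikeSolutions lam θ₁ j).encard := by
    intro j hj1 hjk
    set ω := Real.sqrt (-lam) with hω
    have hsq : ω ^ 2 = -lam := Real.sq_sqrt (by nlinarith [sq_nonneg Ω])
    have R := hR ω (Real.le_sqrt_of_sq_le (by linarith))
    obtain ⟨U, V, A, hU, hV, hA, hshot, hconst⟩ := exists_shots (by linarith [R.pi_lt_T,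
      Real.pi_pos]) R.T_lt (lipschitzWith_toroForce R.one_lt_M) (ω ^ 2)
    obtain ⟨i, rfl⟩ : ∃ i, j = i + 1 := ⟨j - 1, by omega⟩
    obtain ⟨d, hd, d', hd', hne, ⟨h1, h2⟩, h3, h4⟩ := R.exists_two hU hV hA hshot hconst
      (i := i) (by omega)
    rw [hsq, neg_neg] at h1 h3
    have hsub : {(Icc 0 θ₁).domRestrict (U d), (Icc 0 θ₁).domRestrict (U d')} ⊆
        toroSpikeSolutions lam θ₁ (i + 1) := by
      rintro v (rfl | rfl)
      · exact ⟨U d, h1, by rw [(hshot d).u_zero]; exact hd, h2, rfl⟩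
      · exact ⟨U d', h3, by rw [(hshot d').u_zero]; exact hd', h4, rfl⟩
    refine le_trans (le_of_eq ?_) (Set.encard_le_encard hsub)
    rw [Set.encard_pair]
    intro heq
    have := congrFun heq ⟨0, le_rfl, by linarith [Real.pi_pos]⟩
    simp only [Set.domRestrict_apply, (hshot d).u_zero, (hshot d').u_zero] at this
    exact hne.ne this
  exact ⟨two_mul_le_encard_toroSolutions hmain, hmain⟩
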